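/- Let $(M_p)_{p\in\mathbb N_0}$ be a sequence of positive numbers satisfying Komatsu's conditions (M.1) $M_p^2\le M_{p-1}M_{p+1}$ for $p\ge 1$; (M.2) there are $A,H>0$ with $M_{p+q}\le A H^{p+q}M_pM_q$ for all $p,q\in\mathbb N_0$; (M.3) $\sum_{q\ge1} M_{q-1}/M_q<\infty$ and there is $A>0$ with $\sum_{q=p+1}^\infty \frac{M_{q-1}}{M_q}\le A\,p\,\frac{M_p}{M_{p+1}}$ for all $p\ge 1$. Put $m_p=M_p/M_{p-1}$, $p\ge1$. For $h>0$ let $\mathcal S^{M_p,h}(\mathbb R)$ be the space of all $\phi\in C^\infty(\mathbb R;\mathbb C)$ with $$\|\phi\|_h=\sup\Bigl\{\frac{h^{\alpha+\beta}|x|^{\beta}|\phi^{(\alpha)}(x)|}{M_\alpha M_\beta}:\ \alpha,\beta\in\mathbb N_0,\ x\in\mathbb R\Bigr\}<\infty ,$$ normed by $\|\cdot\|_h$. Let $\mathcal S^{(M_p)}(\mathbb R)$ be their projective limit as $h\to\infty$ (the intersection over all $h>0$), and $\mathcal S^{\{M_p\}}(\mathbb R)$ their locally convex inductive limit as $h\to0$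 (the union over all $h>0$). For $L>0$, respectively for a sequence $(L_p)_{p\ge1}$ of real numbers tending to $0$, the products $$P_L(\zeta)=\prod_{p=1}^\infty\Bigl(1+\frac{L^2}{m_p^2}\zeta^2\Bigr),\qquad P_{L_p}(\zeta)=\prod_{p=1}^\infty\Bigl(1+\frac{L_p^2}{m_p^2}\zeta^2\Bigr)$$ converge for all $\zeta\in\mathbb C$ and are the sums of their Taylor series $\sum_{p\ge0}a_p\zeta^p$ on $\mathbb C$. Let $P(i\,d/dt)\phi=\sum_{p\ge 0}a_p i^p\phi^{(p)}$ denote the corresponding operators. Then the series defining $P_L(i\,d/dt)\phi$ converges at every point of $\mathbb R$ for every $\phi\in\mathcal S^{(M_p)}(\mathbb R)$, the series defining $P_{L_p}(i\,d/dt)\phi$ converges at every point of $\mathbb R$ for every $\phi\in\mathcal S^{\{M_p\}}(\mathbb R)$, and the mappings $$P_L(i\,d/dt):\mathcal S^{(M_p)}(\mathbb R)\to\mathcal S^{(M_p)}(\mathbb R),\qquad P_{L_p}(i\,d/dt):\mathcal S^{\{M_p\}}(\mathbb R)\to\mathcal S^{\{M_p\}}(\mathbb R)$$ are continuous linear bijections.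 -/

import Mathlib

open scoped ContDiff Topology
open Filter

/-- A sequence of positive numbers satisfying Komatsu's conditions (M.1) (logarithmic convexity),
(M.2) (stability under ultradifferential operators) and (M.3) (strong non-quasi-analyticity). -/
structure IsWeightSequence (M : ℕ → ℝ) : Prop where
  pos : ∀ p, 0 < M p
  m1 : ∀ p, M (p + 1) ^ 2 ≤ M p * M (p + 2)
  m2 : ∃ A H : ℝ, 0 < A ∧ 0 < H ∧ ∀ p q, M (p + q) ≤ A * H ^ (p + q) * (M p * M q)
  m3 : Summable (fun q => M q / M (q + 1)) ∧
    ∃ A : ℝ, 0 < A ∧ ∀ p : ℕ, 1 ≤ p →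
      ∑' q, M (p + q) / M (p + q + 1) ≤ A * p * (M p / M (p + 1))

/-- `m_p = M_p / M_{p-1}`, used for `p ≥ 1` only. -/
noncomputable def weightRatio (M : ℕ → ℝ) (p : ℕ) : ℝ := M p / M (p - 1)

namespace UltraTest

/-- `h^(α+β) |x|^β |φ^(α)(x)| / (M_α M_β)` (for `h > 0` and `M > 0`). Its supremum over `β` is
`h^α |φ^(α)(x)| e^{M(h|x|)} / M_α` up to the constant factor `M_0`, where
`M(ρ) = sup_β log (ρ^β M_0 / M_β)` is the associated function. -/
noncomputable def weighted (M : ℕ → ℝ) (h : ℝ) (φ : ℝ → ℂ) (i : ℕ × ℕ × ℝ) : ℝ :=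
  |h ^ (i.1 + i.2.1) * i.2.2 ^ i.2.1 / (M i.1 * M i.2.1)| * ‖iteratedDeriv i.1 φ i.2.2‖

lemma weighted_nonneg (M : ℕ → ℝ) (h : ℝ) (φ : ℝ → ℂ) (i : ℕ × ℕ × ℝ) :
    0 ≤ weighted M h φ i := by
  unfold weighted; positivity

lemma weighted_zero (M : ℕ → ℝ) (h : ℝ) (i : ℕ × ℕ × ℝ) : weighted M h 0 i = 0 := by
  simp [weighted]

lemma weighted_add (M : ℕ → ℝ) (h : ℝ) {φ ψ : ℝ → ℂ} (hφ : ContDiff ℝ ∞ φ)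
    (hψ : ContDiff ℝ ∞ ψ) (i : ℕ × ℕ × ℝ) :
    weighted M h (φ + ψ) i ≤ weighted M h φ i + weighted M h ψ i := by
  have e : iteratedDeriv i.1 (φ + ψ) i.2.2 =
      iteratedDeriv i.1 φ i.2.2 + iteratedDeriv i.1 ψ i.2.2 :=
    iteratedDeriv_add (hφ.contDiffAt.of_le (by exact_mod_cast le_top))
      (hψ.contDiffAt.of_le (by exact_mod_cast le_top))
  unfold weighted
  rw [e, ← mul_add]
  exact mul_le_mul_of_nonneg_left (norm_add_le _ _) (abs_nonneg _)

lemma weighted_smul (M : ℕ → ℝ) (h : ℝ) (c : ℂ) {φ : ℝ → ℂ} (hφ : ContDiff ℝ ∞ φ)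
    (i : ℕ × ℕ × ℝ) : weighted M h (c • φ) i = ‖c‖ * weighted M h φ i := by
  have e : iteratedDeriv i.1 (c • φ) i.2.2 = c • iteratedDeriv i.1 φ i.2.2 :=
    iteratedDeriv_const_smul (hφ.contDiffAt.of_le (by exact_mod_cast le_top)) c
  unfold weighted
  rw [e, norm_smul]; ring

lemma weighted_mono (M : ℕ → ℝ) {h h' : ℝ} (h0 : 0 < h') (hh : h' ≤ h) (φ : ℝ → ℂ)
    (i : ℕ × ℕ × ℝ) : weighted M h' φ i ≤ weighted M h φ i := by
  unfold weighted
  simp only [abs_div, abs_mul, abs_pow, abs_of_pos h0, abs_of_pos (h0.trans_le hh)]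
  gcongr

/-- The smooth functions `φ` with `sup_{α,β,x} h^(α+β) |x|^β |φ^(α)(x)| / (M_α M_β) < ∞`. -/
def stepSubmodule (M : ℕ → ℝ) (h : ℝ) : Submodule ℂ (ℝ → ℂ) where
  carrier := {φ | ContDiff ℝ ∞ φ ∧ BddAbove (Set.range (weighted M h φ))}
  zero_mem' := ⟨contDiff_const, 0, by rintro _ ⟨i, rfl⟩; exact (weighted_zero M h i).le⟩
  add_mem' := by
    rintro φ ψ ⟨hφ, C, hC⟩ ⟨hψ, D, hD⟩
    refine ⟨hφ.add hψ, C + D, ?_⟩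
    rintro _ ⟨i, rfl⟩
    exact (weighted_add M h hφ hψ i).trans (add_le_add (hC ⟨i, rfl⟩) (hD ⟨i, rfl⟩))
  smul_mem' := by
    rintro c φ ⟨hφ, C, hC⟩
    refine ⟨contDiff_const.smul hφ, ‖c‖ * C, ?_⟩
    rintro _ ⟨i, rfl⟩
    rw [weighted_smul M h c hφ]
    exact mul_le_mul_of_nonneg_left (hC ⟨i, rfl⟩) (norm_nonneg _)

/-- The space `S^{M_p,h}(ℝ)`. A type of its own, so that it does not carry the topology of
pointwise convergence. -/
def StepSpace (M : ℕ → ℝ) (h : ℝ) : Type := ↥(stepSubmodule M h)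

noncomputable instance (M : ℕ → ℝ) (h : ℝ) : AddCommGroup (StepSpace M h) :=
  inferInstanceAs (AddCommGroup ↥(stepSubmodule M h))

noncomputable instance (M : ℕ → ℝ) (h : ℝ) : Module ℂ (StepSpace M h) :=
  inferInstanceAs (Module ℂ ↥(stepSubmodule M h))

/-- The norm `sup_{α,β,x} h^(α+β) |x|^β |φ^(α)(x)| / (M_α M_β)` of `S^{M_p,h}(ℝ)`. -/
noncomputable def stepNorm (M : ℕ → ℝ) (h : ℝ) : Seminorm ℂ (StepSpace M h) :=
  Seminorm.of (fun φ => ⨆ i, weighted M h φ.1 i)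
    (fun φ ψ => by
      refine ciSup_le fun i => ?_
      exact (weighted_add M h φ.2.1 ψ.2.1 i).trans
        (add_le_add (le_ciSup φ.2.2 i) (le_ciSup ψ.2.2 i)))
    (fun c φ => by
      rw [Real.mul_iSup_of_nonneg (norm_nonneg c)]
      exact iSup_congr fun i => weighted_smul M h c φ.2.1 i)

noncomputable instance (M : ℕ → ℝ) (h : ℝ) : TopologicalSpace (StepSpace M h) :=
  (stepNorm M h).toAddGroupSeminorm.toSeminormedAddGroup.toPseudoMetricSpace.toUniformSpace.toTopologicalSpace

/-- The functions in the Beurling test space: those in `S^{M_p,h}(ℝ)` for every `h > 0`. -/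
def beurlingSubmodule (M : ℕ → ℝ) : Submodule ℂ (ℝ → ℂ) :=
  ⨅ (h : ℝ) (_ : 0 < h), stepSubmodule M h

lemma mem_step_of_beurling {M : ℕ → ℝ} {φ : ℝ → ℂ} (hφ : φ ∈ beurlingSubmodule M) {h : ℝ}
    (hh : 0 < h) : φ ∈ stepSubmodule M h := by
  simp only [beurlingSubmodule, Submodule.mem_iInf] at hφ
  exact hφ h hh

/-- The functions in the Roumieu test space: those in `S^{M_p,h}(ℝ)` for some `h > 0`. -/
def roumieuSubmodule (M : ℕ → ℝ) : Submodule ℂ (ℝ → ℂ) where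
  carrier := {φ | ∃ h : ℝ, 0 < h ∧ φ ∈ stepSubmodule M h}
  zero_mem' := ⟨1, one_pos, Submodule.zero_mem _⟩
  add_mem' := by
    have key : ∀ {h h' : ℝ} {φ : ℝ → ℂ}, 0 < h' → h' ≤ h → φ ∈ stepSubmodule M h →
        φ ∈ stepSubmodule M h' := by
      rintro h h' φ h0 hh ⟨hφ, C, hC⟩
      refine ⟨hφ, C, ?_⟩
      rintro _ ⟨i, rfl⟩
      exact (weighted_mono M h0 hh φ i).trans (hC ⟨i, rfl⟩)
    rintro φ ψ ⟨h, hh, hφ⟩ ⟨k, hk, hψ⟩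
    have hm : 0 < min h k := lt_min hh hk
    exact ⟨min h k, hm, Submodule.add_mem _ (key hm (min_le_left _ _) hφ)
      (key hm (min_le_right _ _) hψ)⟩
  smul_mem' := by
    rintro c φ ⟨h, hh, hφ⟩
    exact ⟨h, hh, Submodule.smul_mem _ c hφ⟩

end UltraTest

open UltraTest

/-- The Beurling test space `S^{(M_p)}(ℝ)`, the projective limit of the `S^{M_p,h}(ℝ)` as
`h → ∞`. -/
def BeurlingS (M : ℕ → ℝ) : Type := ↥(beurlingSubmodule M)

/-- The Roumieu test space `S^{{M_p}}(ℝ)`, the inductive limit of the `S^{M_p,h}(ℝ)` as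
`h → 0`. -/
def RoumieuS (M : ℕ → ℝ) : Type := ↥(roumieuSubmodule M)

namespace BeurlingS

noncomputable instance (M : ℕ → ℝ) : AddCommGroup (BeurlingS M) :=
  inferInstanceAs (AddCommGroup ↥(beurlingSubmodule M))

noncomputable instance (M : ℕ → ℝ) : Module ℂ (BeurlingS M) :=
  inferInstanceAs (Module ℂ ↥(beurlingSubmodule M))

instance (M : ℕ → ℝ) : CoeFun (BeurlingS M) (fun _ => ℝ → ℂ) := ⟨fun φ => φ.1⟩

/-- The inclusion of `S^{(M_p)}(ℝ)` into `S^{M_p,h}(ℝ)`, `h > 0`. -/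
def toStep (M : ℕ → ℝ) (h : ℝ) (hh : 0 < h) (φ : BeurlingS M) : StepSpace M h :=
  ⟨φ.1, mem_step_of_beurling φ.2 hh⟩

/-- The projective limit topology: the coarsest one for which all the inclusions into
`S^{M_p,h}(ℝ)` are continuous. -/
noncomputable instance (M : ℕ → ℝ) : TopologicalSpace (BeurlingS M) :=
  ⨅ (h : ℝ) (hh : 0 < h), TopologicalSpace.induced (toStep M h hh) inferInstance

end BeurlingS

namespace RoumieuS

noncomputable instance (M : ℕ → ℝ) : AddCommGroup (RoumieuS M) :=
  inferInstanceAs (AddCommGroup ↥(roumieuSubmodule M))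

noncomputable instance (M : ℕ → ℝ) : Module ℂ (RoumieuS M) :=
  inferInstanceAs (Module ℂ ↥(roumieuSubmodule M))

noncomputable instance (M : ℕ → ℝ) : Module ℝ (RoumieuS M) :=
  inferInstanceAs (Module ℝ ↥(roumieuSubmodule M))

instance (M : ℕ → ℝ) : CoeFun (RoumieuS M) (fun _ => ℝ → ℂ) := ⟨fun φ => φ.1⟩

/-- The inclusion of `S^{M_p,h}(ℝ)`, `h > 0`, into `S^{{M_p}}(ℝ)`. -/
def ofStep (M : ℕ → ℝ) (h : ℝ) (hh : 0 < h) (φ : StepSpace M h) : RoumieuS M :=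
  ⟨φ.1, h, hh, φ.2⟩

/-- The locally convex inductive limit topology: the finest locally convex vector space topology
for which all the inclusions of `S^{M_p,h}(ℝ)`, `h > 0`, are continuous. -/
noncomputable instance (M : ℕ → ℝ) : TopologicalSpace (RoumieuS M) :=
  sInf {t : TopologicalSpace (RoumieuS M) |
    @IsTopologicalAddGroup (RoumieuS M) t _ ∧ @ContinuousSMul ℂ (RoumieuS M) _ _ t ∧
    @LocallyConvexSpace ℝ (RoumieuS M) _ _ _ _ t ∧
    ∀ (h : ℝ) (hh : 0 < h), @Continuous _ _ _ t (ofStep M h hh)}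

end RoumieuS

/-- The factor with index `p + 1` of the symbol, `1 + L_{p+1}² ζ² / m_{p+1}²`, so that
`p = 0, 1, 2, …` runs through the factors with index `1, 2, 3, …`. -/
noncomputable def symbolFactor (M L : ℕ → ℝ) (ζ : ℂ) (p : ℕ) : ℂ :=
  1 + (L (p + 1) : ℂ) ^ 2 / (weightRatio M (p + 1) : ℂ) ^ 2 * ζ ^ 2

/-- The symbol `P_{L_p}(ζ) = ∏_{p ≥ 1} (1 + L_p² ζ² / m_p²)`; a constant sequence `L` gives
`P_L`. -/
noncomputable def ultraSymbol (M L : ℕ → ℝ) (ζ : ℂ) : ℂ := ∏' p, symbolFactor M L ζ p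

/-- The Taylor coefficients `a_p` of the symbol at `0`. -/
noncomputable def symbolCoeff (M L : ℕ → ℝ) (p : ℕ) : ℂ :=
  iteratedDeriv p (ultraSymbol M L) 0 / (p.factorial : ℂ)

/-- The symbol is a convergent infinite product, and it is everywhere the sum of its power series
`∑ a_p ζ^p`. -/
def SymbolExpands (M L : ℕ → ℝ) : Prop :=
  ∀ ζ : ℂ, HasProd (symbolFactor M L ζ) (ultraSymbol M L ζ) ∧
    HasSum (fun p => symbolCoeff M L p * ζ ^ p) (ultraSymbol M L ζ)

/-- `ψ = P(i d/dt) φ = ∑ a_p i^p φ^(p)`, the series being convergent at every point. -/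
def IsUltraDeriv (M L : ℕ → ℝ) (φ ψ : ℝ → ℂ) : Prop :=
  ∀ t : ℝ, HasSum (fun p => symbolCoeff M L p * Complex.I ^ p * iteratedDeriv p φ t) (ψ t)

/-! On the real line the symbol is `∏ (1 + c_p² t²)` with `c_p = L_p / m_p`, and `∑ |c_p|` converges
by (M.3). Each `(1 + c² t²)⁻¹` is the characteristic function of `c X` with `X` a Laplace variable,
so `1 / P` is the characteristic function of the law `μ` of `∑ c_p X_p`, the `X_p` being independent
(`exists_measure_charFun_eq_prod`). Under the Fourier transform `P(i d/dt)` becomes multiplication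
by `P(-2πξ)` and convolution with `μ` becomes multiplication by `1 / P(-2πξ)`. Hence `μ * P(i d/dt)
φ = φ` (`measureConv_infiniteOrderOp`), and the other order follows because convolution commutes
with the operator (`hasSum_mul_iteratedDeriv_measureConv`). The law `μ` has an exponential moment
and `n! = O(εⁿ M_n)` for every `ε > 0`, so convolution maps the step space of parameter `h` into
that of parameter `h / 2` (`measureConv_mem`); it therefore acts on both limit spaces.

That the operator itself acts continuously rests on Cauchy estimates on the circle of radius `t
m_{p+1}`. If `|L_q| t ≤ 1` eventually, then `a_p = O((K / t)^p / M_p)` (`exists_symbolCoeff_le`,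
from the product bound `exists_prod_ratio_le`). By (M.2) the operator is then bounded from step `h`
to step `h / H` once `t h` exceeds a constant. A constant `L` allows `t = 1 / L`, which covers all
large `h` and suits the projective limit. If `L_p → 0`, every `t` is allowed, so every `h` is
covered, as the inductive limit requires. -/

/-! ### Consequences of (M.1), (M.2), (M.3) for the weight sequence. -/

namespace IsWeightSequence

variable {M : ℕ → ℝ}

lemma ratio_pos (hM : IsWeightSequence M) (q : ℕ) : 0 < M (q + 1) / M q :=
  div_pos (hM.pos _) (hM.pos _)

lemma ratio_monotone (hM : IsWeightSequence M) : Monotone fun q => M (q + 1) / M q := by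
  refine monotone_nat_of_le_succ fun q => ?_
  rw [div_le_div_iff₀ (hM.pos _) (hM.pos _)]
  have := hM.m1 q
  nlinarith

/-- `M_{p+k} / M_p` is a product of `k` increasing ratios, the smallest being `m_{p+1}`. -/
lemma ratio_pow_mul_le (hM : IsWeightSequence M) (p k : ℕ) :
    (M (p + 1) / M p) ^ k * M p ≤ M (p + k) := by
  induction k with
  | zero => simp
  | succ k ih =>
    have h1 : M (p + 1) / M p ≤ M (p + k + 1) / M (p + k) := hM.ratio_monotone (Nat.le_add_right p k)
    calc (M (p + 1) / M p) ^ (k + 1) * M p = (M (p + 1) / M p) * ((M (p + 1) / M p) ^ k * M p) := by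
          ring
      _ ≤ (M (p + k + 1) / M (p + k)) * M (p + k) := by
          have := (hM.ratio_pos p).le
          have := (hM.ratio_pos (p + k)).le
          have := (hM.pos p).le
          gcongr
      _ = M (p + (k + 1)) := by rw [div_mul_cancel₀ _ (hM.pos _).ne']; rfl

lemma le_mul_ratio_pow (hM : IsWeightSequence M) {q p : ℕ} (hqp : q ≤ p) :
    M q ≤ M 0 * (M (p + 1) / M p) ^ q := by
  induction q with
  | zero => simp
  | succ q ih =>
    have h1 : M (q + 1) / M q ≤ M (p + 1) / M p := hM.ratio_monotone (by lia)
    calc M (q + 1) = M (q + 1) / M q * M q := by rw [div_mul_cancel₀ _ (hM.pos _).ne']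
      _ ≤ M (p + 1) / M p * (M 0 * (M (p + 1) / M p) ^ q) := by
          have := (hM.ratio_pos p).le
          have := (hM.pos q).le
          have := ih (by lia)
          gcongr
      _ = M 0 * (M (p + 1) / M p) ^ (q + 1) := by ring

/-- Taking `H ≥ 1` makes powers of `H` monotone in the exponent and makes `h / H` a genuine loss. -/
lemma exists_stability (hM : IsWeightSequence M) :
    ∃ A H : ℝ, 0 < A ∧ 1 ≤ H ∧ ∀ p q, M (p + q) ≤ A * H ^ (p + q) * (M p * M q) := by
  obtain ⟨A, H, hA, hH, h⟩ := hM.m2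
  refine ⟨A, max H 1, hA, le_max_right _ _, fun p q => (h p q).trans ?_⟩
  have := (mul_pos (hM.pos p) (hM.pos q)).le
  gcongr
  exact le_max_left _ _

/-- The products `∏ (1 + (m_{p+1} / m_{q+1})²)` grow at most geometrically in `p`. -/
lemma exists_prod_ratio_le (hM : IsWeightSequence M) :
    ∃ C K : ℝ, 0 < C ∧ 0 < K ∧ ∀ p n : ℕ,
      ∏ q ∈ Finset.range n, (1 + (M (p + 1) / M p) ^ 2 / (M (q + 1) / M q) ^ 2) ≤ C * K ^ p := by
  obtain ⟨A, H, hA, hH, h2⟩ := hM.exists_stability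
  obtain ⟨hs, B, hB, h3⟩ := hM.m3
  set r : ℕ → ℝ := fun q => M (q + 1) / M q with hr
  have rpos : ∀ q, 0 < r q := hM.ratio_pos
  have rmono : Monotone r := hM.ratio_monotone
  set S := ∑' q, M q / M (q + 1) with hS
  have hS0 : 0 ≤ S := tsum_nonneg fun q => (div_pos (hM.pos _) (hM.pos _)).le
  -- Here `r p = m_{p+1}`. For `q < p` the quotient `r p / r q` is at least 1, so each factor is at
  -- most twice its square; the product of the `r q` telescopes to `M_p / M_0`, and (M.2) for the
  -- pair `(p, p)` bounds `r p ^ p / M_p`.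
  have head : ∀ p, ∏ q ∈ Finset.range p, (1 + r p ^ 2 / r q ^ 2) ≤
      (A * M 0) ^ 2 * (2 * H ^ 4) ^ p := by
    intro p
    have e1 : ∏ q ∈ Finset.range p, (1 + r p ^ 2 / r q ^ 2) ≤
        ∏ q ∈ Finset.range p, (2 * (r p / r q) ^ 2) := by
      refine Finset.prod_le_prod (fun q _ => by positivity) fun q hq => ?_
      have h1 : 1 ≤ r p / r q :=
        (one_le_div (rpos q)).2 (rmono (Finset.mem_range.1 hq).le)
      rw [← div_pow]
      nlinarith
    have e2 : ∏ q ∈ Finset.range p, r q = M p / M 0 := by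
      clear e1
      induction p with
      | zero => simp [(hM.pos 0).ne']
      | succ p ih =>
        have := (hM.pos p).ne'
        rw [Finset.prod_range_succ, ih]
        simp only [hr]
        field_simp
    have e3 : ∏ q ∈ Finset.range p, (2 * (r p / r q) ^ 2) =
        2 ^ p * (r p ^ p / (M p / M 0)) ^ 2 := by
      rw [Finset.prod_mul_distrib, Finset.prod_pow, Finset.prod_div_distrib, e2]
      simp
    have e4 : r p ^ p / (M p / M 0) ≤ A * M 0 * (H ^ 2) ^ p := by
      have := (hM.ratio_pow_mul_le p p).trans (h2 p p)
      have hp := hM.pos p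
      have h0 := hM.pos 0
      have h5 : r p ^ p ≤ A * H ^ (p + p) * M p :=
        le_of_mul_le_mul_right (by linarith) hp
      rw [div_le_iff₀ (div_pos hp h0)]
      calc _ ≤ _ := h5
        _ = _ := by rw [← two_mul, pow_mul]; field_simp
    have e5 : 0 ≤ r p ^ p / (M p / M 0) := by
      have := rpos p
      have := hM.pos p
      have := hM.pos 0
      positivity
    calc _ ≤ _ := e1
      _ = _ := e3
      _ ≤ 2 ^ p * (A * M 0 * (H ^ 2) ^ p) ^ 2 := by gcongr
      _ = _ := by rw [mul_pow 2, ← pow_mul H 4 p, mul_pow, ← pow_mul, ← pow_mul]; ring_nf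
  -- For indices from `p` on the quotient `x` is at most 1, so `1 + x² ≤ exp x`, and (M.3) bounds
  -- the sum of the quotients by `B p`. Its bound needs `p ≥ 1`; the constant `exp (r 0 * S)` takes
  -- care of `p = 0`.
  have tail : ∀ p n, ∏ i ∈ Finset.range n, (1 + r p ^ 2 / r (p + i) ^ 2) ≤
      Real.exp (r 0 * S) * Real.exp B ^ p := by
    intro p n
    have e1 : ∏ i ∈ Finset.range n, (1 + r p ^ 2 / r (p + i) ^ 2) ≤
        ∏ i ∈ Finset.range n, Real.exp (r p * (M (p + i) / M (p + i + 1))) := by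
      refine Finset.prod_le_prod (fun q _ => by positivity) fun q _ => ?_
      have h1 : r p / r (p + q) ≤ 1 := (div_le_one (rpos _)).2 (rmono (Nat.le_add_right _ _))
      have h0 : 0 < r p / r (p + q) := div_pos (rpos _) (rpos _)
      have h2 : r p * (M (p + q) / M (p + q + 1)) = r p / r (p + q) := by
        simp [hr, div_div_eq_mul_div, mul_div_assoc]
      rw [h2, ← div_pow]
      have := Real.add_one_le_exp (r p / r (p + q))
      nlinarith
    have hsp : Summable fun i => M (p + i) / M (p + i + 1) := by
      simpa [add_comm] using (summable_nat_add_iff p).2 hs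
    have e2 : ∑ i ∈ Finset.range n, r p * (M (p + i) / M (p + i + 1)) ≤ r 0 * S + p * B := by
      rw [← Finset.mul_sum]
      have h4 : ∑ i ∈ Finset.range n, (M (p + i) / M (p + i + 1)) ≤
          ∑' i, M (p + i) / M (p + i + 1) :=
        hsp.sum_le_tsum _ fun i _ => (div_pos (hM.pos _) (hM.pos _)).le
      rcases Nat.eq_zero_or_pos p with rfl | hp
      · have := mul_le_mul_of_nonneg_left h4 (rpos 0).le
        simpa [hS] using this
      · have h5 := mul_le_mul_of_nonneg_left (h4.trans (h3 p hp)) (rpos p).le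
        have h6 : r p * (B * p * (M p / M (p + 1))) = p * B := by
          have := hM.pos p
          have := hM.pos (p + 1)
          simp only [hr]; field_simp
        have := mul_nonneg (rpos 0).le hS0
        linarith
    calc _ ≤ _ := e1
      _ = Real.exp (∑ i ∈ Finset.range n, r p * (M (p + i) / M (p + i + 1))) :=
          (Real.exp_sum _ _).symm
      _ ≤ Real.exp (r 0 * S + p * B) := Real.exp_le_exp.2 e2
      _ = _ := by rw [Real.exp_add, Real.exp_nat_mul]
  refine ⟨(A * M 0) ^ 2 * Real.exp (r 0 * S), 2 * H ^ 4 * Real.exp B, ?_, by positivity,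
    fun p n => ?_⟩
  · have := hM.pos 0
    positivity
  calc ∏ q ∈ Finset.range n, (1 + r p ^ 2 / r q ^ 2)
      ≤ ∏ q ∈ Finset.range (p + n), (1 + r p ^ 2 / r q ^ 2) := by
        refine Finset.prod_le_prod_of_subset_of_one_le ?_ (fun _ _ => by positivity) ?_
        · exact Finset.range_mono (Nat.le_add_left _ _)
        · intro i _ _
          have : 0 ≤ r p ^ 2 / r i ^ 2 := by positivity
          linarith
    _ = (∏ q ∈ Finset.range p, (1 + r p ^ 2 / r q ^ 2)) *
        ∏ i ∈ Finset.range n, (1 + r p ^ 2 / r (p + i) ^ 2) := Finset.prod_range_add _ _ _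
    _ ≤ ((A * M 0) ^ 2 * (2 * H ^ 4) ^ p) * (Real.exp (r 0 * S) * Real.exp B ^ p) :=
        mul_le_mul (head p) (tail p n) (Finset.prod_nonneg fun _ _ => by positivity)
          (by positivity)
    _ = _ := by rw [mul_pow _ (Real.exp B)]; ring

/-- The terms of a convergent decreasing series are `o(1/n)`: the block from `n / 2` to `n` has at
least `n / 2` terms, each at least the `n`-th, and its sum tends to 0. -/
lemma tendsto_mul_inv_ratio (hM : IsWeightSequence M) :
    Tendsto (fun n : ℕ => (n : ℝ) * (M n / M (n + 1))) atTop (𝓝 0) := by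
  set x : ℕ → ℝ := fun q => M q / M (q + 1) with hx
  have x0 : ∀ q, 0 < x q := fun q => div_pos (hM.pos _) (hM.pos _)
  have anti : Antitone x := by
    intro a b hab
    have := hM.ratio_monotone hab
    have h1 := inv_anti₀ (hM.ratio_pos a) this
    simpa [hx] using h1
  have hs := hM.m3.1.hasSum.tendsto_sum_nat
  have hhalf : Tendsto (fun n : ℕ => n / 2) atTop atTop :=
    Nat.tendsto_div_const_atTop (by norm_num)
  have hd := ((hs.sub (hs.comp hhalf)).const_mul 2)
  simp only [sub_self, mul_zero] at hd
  refine squeeze_zero (fun n => mul_nonneg n.cast_nonneg (x0 n).le) (fun n => ?_) hd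
  have h1 : ∑ i ∈ Finset.range n, x i - ∑ i ∈ Finset.range (n / 2), x i =
      ∑ i ∈ Finset.Ico (n / 2) n, x i :=
    (Finset.sum_Ico_eq_sub _ (Nat.div_le_self _ _)).symm
  have h2 : ((n - n / 2 : ℕ) : ℝ) * x n ≤ ∑ i ∈ Finset.Ico (n / 2) n, x i := by
    have := Finset.card_nsmul_le_sum (Finset.Ico (n / 2) n) x (x n)
      fun i hi => anti (Finset.mem_Ico.1 hi).2.le
    simpa [Nat.card_Ico, nsmul_eq_mul] using this
  have h3 : (n : ℝ) ≤ 2 * ((n - n / 2 : ℕ) : ℝ) := by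
    have : n ≤ 2 * (n - n / 2) := by lia
    exact_mod_cast this
  have h4 := mul_le_mul_of_nonneg_right h3 (x0 n).le
  simp only [Function.comp]
  change (n : ℝ) * x n ≤ 2 * (∑ i ∈ Finset.range n, x i - ∑ i ∈ Finset.range (n / 2), x i)
  rw [h1]
  linarith

/-- Factorials are of smaller order than `ε^n M_n`, for every `ε > 0`. -/
lemma exists_factorial_le (hM : IsWeightSequence M) {ε : ℝ} (hε : 0 < ε) :
    ∃ C : ℝ, 0 < C ∧ ∀ n : ℕ, (n.factorial : ℝ) ≤ C * (ε ^ n * M n) := by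
  -- This is the inductive step `n → n + 1` of the claim. The limit is used with `ε / 2` because `n
  -- + 1 ≤ 2 n`.
  have ev : ∀ᶠ n : ℕ in atTop, ((n + 1 : ℕ) : ℝ) * M n ≤ ε * M (n + 1) := by
    have h := hM.tendsto_mul_inv_ratio.eventually (gt_mem_nhds (half_pos hε))
    filter_upwards [h, eventually_ge_atTop 1] with n hn h1
    have hp := hM.pos (n + 1)
    have h1' : (1 : ℝ) ≤ n := by exact_mod_cast h1
    have h2 : (n : ℝ) * M n ≤ ε / 2 * M (n + 1) := by
      rw [← mul_div_assoc, div_lt_iff₀ hp] at hn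
      exact hn.le
    have h3 : M n ≤ n * M n := le_mul_of_one_le_left (hM.pos n).le h1'
    push_cast
    nlinarith
  obtain ⟨N, hN⟩ := eventually_atTop.1 ev
  have hpos : ∀ n, 0 < ε ^ n * M n := fun n => mul_pos (pow_pos hε n) (hM.pos n)
  -- The constant dominates each of the finitely many quotients that precede the inductive range.
  refine ⟨1 + ∑ i ∈ Finset.range (N + 1), (i.factorial : ℝ) / (ε ^ i * M i), ?_, ?_⟩
  · have : 0 ≤ ∑ i ∈ Finset.range (N + 1), (i.factorial : ℝ) / (ε ^ i * M i) :=
      Finset.sum_nonneg fun i _ => div_nonneg (by positivity) (hpos i).le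
    linarith
  set C := 1 + ∑ i ∈ Finset.range (N + 1), (i.factorial : ℝ) / (ε ^ i * M i) with hC
  have small : ∀ n ≤ N, (n.factorial : ℝ) ≤ C * (ε ^ n * M n) := by
    intro n hn
    rw [← div_le_iff₀ (hpos n)]
    have := Finset.single_le_sum (f := fun i : ℕ => (i.factorial : ℝ) / (ε ^ i * M i))
      (fun i _ => div_nonneg (by positivity) (hpos i).le) (Finset.mem_range.2 (Nat.lt_succ_of_le hn))
    linarith
  intro n
  rcases le_total n N with h | h
  · exact small n h
  · induction n, h using Nat.le_induction with
    | base => exact small N le_rfl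
    | succ n hn ih =>
      have h1 := hN n hn
      have hC0 : 0 < C := pos_of_mul_pos_left
        (lt_of_lt_of_le (by positivity) ih) (hpos n).le
      calc ((n + 1).factorial : ℝ) = ((n + 1 : ℕ) : ℝ) * n.factorial := by
            rw [Nat.factorial_succ]; push_cast; ring
        _ ≤ ((n + 1 : ℕ) : ℝ) * (C * (ε ^ n * M n)) := by gcongr
        _ = C * ε ^ n * (((n + 1 : ℕ) : ℝ) * M n) := by ring
        _ ≤ C * ε ^ n * (ε * M (n + 1)) := by gcongr
        _ = _ := by ring

end IsWeightSequence

/-! ### Infinite products of the form `∏ (1 + c_p ζ²)`. -/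

section EntireProduct

variable {c : ℕ → ℂ}

lemma differentiable_tprod_one_add_mul_sq (hc : Summable fun p => ‖c p‖) :
    Differentiable ℂ fun ζ : ℂ => ∏' p, (1 + c p * ζ ^ 2) := by
  intro ζ₀
  have hloc : HasProdLocallyUniformlyOn (fun p ζ => 1 + c p * ζ ^ 2)
      (fun ζ => ∏' p, (1 + c p * ζ ^ 2)) (Metric.ball (0 : ℂ) (‖ζ₀‖ + 1)) := by
    refine Summable.hasProdLocallyUniformlyOn_nat_one_add (u := fun p => ‖c p‖ * (‖ζ₀‖ + 1) ^ 2)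
      Metric.isOpen_ball (hc.mul_right _) ?_ fun p => by fun_prop
    refine Eventually.of_forall fun p ζ hζ => ?_
    rw [norm_mul, norm_pow]
    have : ‖ζ‖ ≤ ‖ζ₀‖ + 1 := (mem_ball_zero_iff.1 hζ).le
    gcongr
  have hd := hloc.tendstoLocallyUniformlyOn_finsetRange.differentiableOn
    (Eventually.of_forall fun n => by fun_prop) Metric.isOpen_ball
  exact hd.differentiableAt (Metric.isOpen_ball.mem_nhds (by simp))

lemma hasProd_one_add_mul_sq (hc : Summable fun p => ‖c p‖) (ζ : ℂ) :
    HasProd (fun p => 1 + c p * ζ ^ 2) (∏' p, (1 + c p * ζ ^ 2)) := by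
  refine (multipliable_one_add_of_summable ?_).hasProd
  simpa only [norm_mul] using hc.mul_right _

end EntireProduct

/-! ### The symbol and the decay of its Taylor coefficients. -/

section Symbol

variable {M L : ℕ → ℝ}

lemma symbolFactor_eq (M L : ℕ → ℝ) (ζ : ℂ) (p : ℕ) :
    symbolFactor M L ζ p = 1 + ((L (p + 1) / (M (p + 1) / M p)) ^ 2 : ℝ) * ζ ^ 2 := by
  simp [symbolFactor, weightRatio, div_pow]

lemma exists_abs_le_of_eventually {t : ℝ} (ht : 0 < t) (hL : ∀ᶠ q in atTop, |L q| * t ≤ 1) :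
    ∃ B : ℝ, ∀ q, |L q| ≤ B := by
  have h : Filter.IsBoundedUnder (· ≤ ·) atTop fun q => |L q| :=
    ⟨1 / t, by
      rw [eventually_map]
      filter_upwards [hL] with q hq
      rwa [le_div_iff₀ ht]⟩
  obtain ⟨B, hB⟩ := h.bddAbove_range
  exact ⟨B, fun q => hB ⟨q, rfl⟩⟩

lemma summable_abs_div_ratio (hM : IsWeightSequence M) {B : ℝ} (hB : ∀ q, |L q| ≤ B) :
    Summable fun q => |L (q + 1) / (M (q + 1) / M q)| := by
  refine Summable.of_nonneg_of_le (fun _ => abs_nonneg _) (fun q => ?_) (hM.m3.1.mul_left B)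
  rw [abs_div, abs_of_pos (hM.ratio_pos q), div_div_eq_mul_div, mul_div_assoc]
  have := div_pos (hM.pos q) (hM.pos (q + 1))
  gcongr
  exact hB _

lemma summable_sq_div_ratio (hM : IsWeightSequence M) {B : ℝ} (hB : ∀ q, |L q| ≤ B) :
    Summable fun q => (L (q + 1) / (M (q + 1) / M q)) ^ 2 := by
  have h := summable_abs_div_ratio hM hB
  refine Summable.of_norm_bounded_eventually_nat h ?_
  filter_upwards [h.tendsto_atTop_zero.eventually (gt_mem_nhds one_pos)] with q hq
  rw [norm_pow, Real.norm_eq_abs]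
  have := abs_nonneg (L (q + 1) / (M (q + 1) / M q))
  nlinarith

lemma ultraSymbol_eq (M L : ℕ → ℝ) : ultraSymbol M L =
    fun ζ => ∏' p, (1 + (((L (p + 1) / (M (p + 1) / M p)) ^ 2 : ℝ) : ℂ) * ζ ^ 2) := by
  funext ζ
  simp only [ultraSymbol, symbolFactor_eq]

lemma hasProd_symbolFactor (hM : IsWeightSequence M) {B : ℝ} (hB : ∀ q, |L q| ≤ B) (ζ : ℂ) :
    HasProd (symbolFactor M L ζ) (ultraSymbol M L ζ) := by
  rw [ultraSymbol_eq, funext (symbolFactor_eq M L ζ)]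
  refine hasProd_one_add_mul_sq ?_ ζ
  simpa only [Complex.norm_real] using (summable_sq_div_ratio hM hB).norm

lemma differentiable_ultraSymbol (hM : IsWeightSequence M) {B : ℝ} (hB : ∀ q, |L q| ≤ B) :
    Differentiable ℂ (ultraSymbol M L) := by
  rw [ultraSymbol_eq]
  refine differentiable_tprod_one_add_mul_sq ?_
  simpa only [Complex.norm_real] using (summable_sq_div_ratio hM hB).norm

lemma symbolExpands (hM : IsWeightSequence M) {B : ℝ} (hB : ∀ q, |L q| ≤ B) :
    SymbolExpands M L := by
  refine fun ζ => ⟨hasProd_symbolFactor hM hB ζ, ?_⟩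
  have := Complex.hasSum_taylorSeries_of_entire (differentiable_ultraSymbol hM hB) 0 ζ
  have e : (fun p : ℕ => symbolCoeff M L p * ζ ^ p) = fun p : ℕ =>
      (p.factorial : ℂ)⁻¹ • (ζ - 0) ^ p • iteratedDeriv p (ultraSymbol M L) 0 := by
    funext p
    simp only [symbolCoeff, sub_zero, smul_eq_mul]
    ring
  rwa [e]

/-- Cauchy estimates for the Taylor coefficients of the symbol. -/
lemma exists_symbolCoeff_le (hM : IsWeightSequence M) :
    ∃ K : ℝ, 0 < K ∧ ∀ (L : ℕ → ℝ) (t : ℝ), 0 < t → (∀ᶠ q in atTop, |L q| * t ≤ 1) →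
      ∃ C : ℝ, 0 < C ∧ ∀ p, ‖symbolCoeff M L p‖ ≤ C * (K / t) ^ p / M p := by
  obtain ⟨C, K, hC, hK, hg⟩ := hM.exists_prod_ratio_le
  refine ⟨K, hK, fun L t ht hL => ?_⟩
  obtain ⟨B, hB⟩ := exists_abs_le_of_eventually ht hL
  -- `b` absorbs the finitely many factors with `|L| t > 1`; its partial products are bounded
  -- because almost all `b q` equal 1.
  set b : ℕ → ℝ := fun q => max 1 ((|L (q + 1)| * t) ^ 2) with hb
  have b1 : ∀ q, 1 ≤ b q := fun q => le_max_left _ _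
  have hprod : ∃ D : ℝ, 0 < D ∧ ∀ n, ∏ q ∈ Finset.range n, b q ≤ D := by
    obtain ⟨N, hN⟩ := eventually_atTop.1 hL
    refine ⟨∏ q ∈ Finset.range N, b q, Finset.prod_pos fun q _ => one_pos.trans_le (b1 q),
      fun n => ?_⟩
    have e : ∀ i, b (N + i) = 1 := fun i =>
      max_eq_left (pow_le_one₀ (by positivity) (hN _ (by lia)))
    calc ∏ q ∈ Finset.range n, b q ≤ ∏ q ∈ Finset.range (N + n), b q :=
          Finset.prod_le_prod_of_subset_of_one_le (Finset.range_mono (Nat.le_add_left _ _))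
            (fun q _ => zero_le_one.trans (b1 q)) fun q _ _ => b1 q
      _ = ∏ q ∈ Finset.range N, b q := by
          rw [Finset.prod_range_add]; simp [e]
  obtain ⟨D, hD, hDn⟩ := hprod
  refine ⟨D * C * M 0, by have := hM.pos 0; positivity, fun p => ?_⟩
  set r := M (p + 1) / M p with hr
  have rpos : 0 < r := hM.ratio_pos p
  -- With radius `t m_{p+1}` each factor is at most `b q * (1 + (m_{p+1} / m_{q+1})²)`, which is
  -- where `exists_prod_ratio_le` applies.
  have hbound : ∀ z ∈ Metric.sphere (0 : ℂ) (t * r), ‖ultraSymbol M L z‖ ≤ D * (C * K ^ p) := by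
    intro z hz
    have hz' : ‖z‖ = t * r := by simpa using hz
    refine le_of_tendsto (hasProd_symbolFactor hM hB z).tendsto_prod_nat.norm
      (Eventually.of_forall fun n => ?_)
    rw [norm_prod]
    calc ∏ q ∈ Finset.range n, ‖symbolFactor M L z q‖
        ≤ ∏ q ∈ Finset.range n, (b q * (1 + r ^ 2 / (M (q + 1) / M q) ^ 2)) := by
          refine Finset.prod_le_prod (fun _ _ => norm_nonneg _) fun q _ => ?_
          rw [symbolFactor_eq]
          refine (norm_add_le _ _).trans ?_
          rw [norm_one, norm_mul, norm_pow, hz', Complex.norm_real, norm_pow, Real.norm_eq_abs,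
            sq_abs]
          have h1 : (L (q + 1) / (M (q + 1) / M q)) ^ 2 * (t * r) ^ 2 =
              (|L (q + 1)| * t) ^ 2 * (r ^ 2 / (M (q + 1) / M q) ^ 2) := by
            rw [mul_pow, mul_pow, div_pow, sq_abs]; ring
          have h2 : (|L (q + 1)| * t) ^ 2 ≤ b q := le_max_right _ _
          have h3 : 0 ≤ r ^ 2 / (M (q + 1) / M q) ^ 2 := by positivity
          rw [h1, mul_add, mul_one]
          exact add_le_add (b1 q) (mul_le_mul_of_nonneg_right h2 h3)
      _ = (∏ q ∈ Finset.range n, b q) *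
          ∏ q ∈ Finset.range n, (1 + r ^ 2 / (M (q + 1) / M q) ^ 2) := Finset.prod_mul_distrib
      _ ≤ D * (C * K ^ p) :=
          mul_le_mul (hDn n) (hg p n) (Finset.prod_nonneg fun _ _ => by positivity) hD.le
  have hcauchy := Complex.norm_iteratedDeriv_le_of_forall_mem_sphere_norm_le p (mul_pos ht rpos)
    (differentiable_ultraSymbol hM hB).diffContOnCl hbound
  have hp := hM.pos p
  have hpf : (0 : ℝ) < p.factorial := by positivity
  have hM0 := hM.le_mul_ratio_pow (le_refl p)
  rw [symbolCoeff, norm_div, Complex.norm_natCast, div_le_iff₀ hpf]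
  refine hcauchy.trans ?_
  -- The radius was chosen so that `r ^ p ≥ M_p / M_0`, which turns the Cauchy bound into decay like
  -- `1 / M_p`.
  have h4 : M p / (t * r) ^ p ≤ M 0 / t ^ p := by
    rw [div_le_div_iff₀ (by positivity) (by positivity), mul_pow]
    calc M p * t ^ p ≤ (M 0 * r ^ p) * t ^ p := by gcongr
      _ = _ := by ring
  calc p.factorial * (D * (C * K ^ p)) / (t * r) ^ p
      = p.factorial * (D * (C * K ^ p)) / M p * (M p / (t * r) ^ p) := by field_simp
    _ ≤ p.factorial * (D * (C * K ^ p)) / M p * (M 0 / t ^ p) := by gcongr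
    _ = _ := by rw [div_pow]; field_simp

end Symbol

/-! ### The Laplace distribution. -/

section Laplace

open MeasureTheory ProbabilityTheory Set

/-- The standard Laplace distribution, with density `exp (-|x|) / 2`. -/
noncomputable def laplaceMeasure : Measure ℝ :=
  volume.withDensity fun x => ENNReal.ofReal (Real.exp (-|x|) / 2)

/-- Used with `s = 0` for the total mass, `s = 1 / 2` for the first moment, and `s = a |c p|` for
the exponential moment of the series. -/
lemma lintegral_exp_mul_abs_laplaceMeasure {s : ℝ} (hs : s < 1) :
    ∫⁻ x, ENNReal.ofReal (Real.exp (s * |x|)) ∂laplaceMeasure = ENNReal.ofReal (1 / (1 - s)) := by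
  have hint : Integrable fun x : ℝ => Real.exp ((s - 1) * |x|) := by
    refine Integrable.of_integral_ne_zero ?_
    rw [integral_comp_abs (f := fun x => Real.exp ((s - 1) * x)),
      integral_exp_mul_Ioi (by linarith)]
    have : s - 1 ≠ 0 := by linarith
    simp [this]
  rw [laplaceMeasure, lintegral_withDensity_eq_lintegral_mul _ (by fun_prop) (by fun_prop)]
  have e : ∀ x : ℝ, ((fun x => ENNReal.ofReal (Real.exp (-|x|) / 2)) * fun x =>
      ENNReal.ofReal (Real.exp (s * |x|))) x =
      ENNReal.ofReal (Real.exp ((s - 1) * |x|) / 2) := by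
    intro x
    rw [Pi.mul_apply, ← ENNReal.ofReal_mul (by positivity), div_mul_eq_mul_div, ← Real.exp_add]
    ring_nf
  rw [lintegral_congr e, ← ofReal_integral_eq_lintegral_ofReal (hint.div_const 2)
    (ae_of_all _ fun x => by positivity), integral_div,
    integral_comp_abs (f := fun x => Real.exp ((s - 1) * x)),
    integral_exp_mul_Ioi (by linarith)]
  congr 1
  have : 1 - s ≠ 0 := by linarith
  have : s - 1 ≠ 0 := by linarith
  simp
  field_simp
  ring

instance : IsProbabilityMeasure laplaceMeasure :=
  ⟨by simpa using lintegral_exp_mul_abs_laplaceMeasure zero_lt_one⟩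

lemma charFun_laplaceMeasure (t : ℝ) : charFun laplaceMeasure t = (1 + (t : ℂ) ^ 2)⁻¹ := by
  rw [charFun_apply_real, laplaceMeasure, integral_withDensity_eq_integral_toReal_smul
    (by fun_prop) (ae_of_all _ fun x => ENNReal.ofReal_lt_top)]
  set f : ℝ → ℂ := fun x => (ENNReal.ofReal (Real.exp (-|x|) / 2)).toReal •
    Complex.exp (t * x * Complex.I) with hf
  have f1 : ∀ x ∈ Iic (0 : ℝ), f x = Complex.exp ((1 + t * Complex.I) * x) / 2 := by
    intro x hx
    rw [hf]
    simp only
    rw [ENNReal.toReal_ofReal (by positivity), abs_of_nonpos hx, neg_neg, Complex.real_smul]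
    push_cast
    rw [div_mul_eq_mul_div, ← Complex.exp_add]
    ring_nf
  have f2 : ∀ x ∈ Ioi (0 : ℝ), f x = Complex.exp ((-1 + t * Complex.I) * x) / 2 := by
    intro x hx
    rw [hf]
    simp only
    rw [ENNReal.toReal_ofReal (by positivity), abs_of_pos hx, Complex.real_smul]
    push_cast
    rw [div_mul_eq_mul_div, ← Complex.exp_add]
    ring_nf
  have r1 : (1 + t * Complex.I).re = 1 := by simp
  have r2 : (-1 + t * Complex.I).re = -1 := by simp
  have i1 : IntegrableOn f (Iic 0) :=
    IntegrableOn.congr_fun ((integrableOn_exp_mul_complex_Iic (by rw [r1]; norm_num) 0).div_const 2)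
      (fun x hx => (f1 x hx).symm) measurableSet_Iic
  have i2 : IntegrableOn f (Ioi 0) :=
    IntegrableOn.congr_fun ((integrableOn_exp_mul_complex_Ioi (by rw [r2]; norm_num) 0).div_const 2)
      (fun x hx => (f2 x hx).symm) measurableSet_Ioi
  rw [← intervalIntegral.integral_Iic_add_Ioi i1 i2, setIntegral_congr_fun measurableSet_Iic f1,
    setIntegral_congr_fun measurableSet_Ioi f2, integral_div, integral_div,
    integral_exp_mul_complex_Iic (by rw [r1]; norm_num),
    integral_exp_mul_complex_Ioi (by rw [r2]; norm_num)]
  have n1 : (1 + t * Complex.I) ≠ 0 := fun h => by rw [h] at r1; simp at r1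
  have n2 : (-1 + t * Complex.I) ≠ 0 := fun h => by rw [h] at r2; simp at r2
  have n3 : (1 + (t : ℂ) ^ 2) ≠ 0 := by
    have : (1 + (t : ℂ) ^ 2) = -((1 + t * Complex.I) * (-1 + t * Complex.I)) := by
      ring_nf; rw [Complex.I_sq]; ring
    rw [this]
    exact neg_ne_zero.2 (mul_ne_zero n1 n2)
  simp only [Complex.ofReal_zero, mul_zero, Complex.exp_zero]
  field_simp
  ring_nf
  rw [Complex.I_sq]
  ring

end Laplace

/-! ### Series of independent Laplace variables. -/

section LaplaceSeries

open MeasureTheory ProbabilityTheory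

/-- For a summable sequence `c`, the law of the series `∑ cₚ Xₚ` of independent Laplace variables
has exponential moments, and its characteristic function is `∏ (1 + cₚ² t²)⁻¹`. -/
lemma exists_measure_charFun_eq_prod {c : ℕ → ℝ} (hc : Summable fun p => |c p|) :
    ∃ μ : Measure ℝ, IsProbabilityMeasure μ ∧
      (∃ a : ℝ, 0 < a ∧ Integrable (fun x => Real.exp (a * |x|)) μ) ∧
      ∀ t : ℝ, Tendsto (fun n => ∏ p ∈ Finset.range n, (1 + ((c p : ℂ) * t) ^ 2)⁻¹) atTop
        (𝓝 (charFun μ t)) := by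
  set P := Measure.infinitePi fun _ : ℕ => laplaceMeasure with hP
  set S : ℕ → (ℕ → ℝ) → ℝ := fun n w => ∑ p ∈ Finset.range n, c p * w p with hS
  set X : (ℕ → ℝ) → ℝ := fun w => ∑' p, c p * w p with hX
  have hSm : ∀ n, Measurable (S n) := fun n => by fun_prop
  have hcm : ∀ p, Measurable fun w : ℕ → ℝ => c p * w p := fun p => by fun_prop
  have hmp : ∀ p, MeasurePreserving (fun w : ℕ → ℝ => w p) P laplaceMeasure :=
    fun p => measurePreserving_eval_infinitePi _ p
  have hlim : ∀ᵐ w ∂P, Tendsto (fun n => S n w) atTop (𝓝 (X w)) := by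
    have h1 : ∫⁻ x, ‖x‖ₑ ∂laplaceMeasure ≠ ⊤ := by
      refine ne_top_of_le_ne_top (ENNReal.mul_ne_top (ENNReal.ofReal_ne_top (r := 2))
        (ENNReal.ofReal_ne_top (r := 1 / (1 - 1 / 2)))) ?_
      rw [← lintegral_exp_mul_abs_laplaceMeasure (by norm_num),
        ← lintegral_const_mul _ (by fun_prop)]
      refine lintegral_mono fun x => ?_
      rw [← ENNReal.ofReal_mul (by norm_num), ← ofReal_norm, Real.norm_eq_abs]
      refine ENNReal.ofReal_le_ofReal ?_
      linarith [Real.add_one_le_exp (1 / 2 * |x|)]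
    -- The series of absolute values has finite expectation `∑ |c p| E|X|`, so the random series
    -- converges absolutely almost surely.
    have h2 : ∫⁻ w, ∑' p, ‖c p * w p‖ₑ ∂P ≠ ⊤ := by
      rw [lintegral_tsum fun p => (hcm p).enorm.aemeasurable]
      have e : ∀ p, ∫⁻ w, ‖c p * w p‖ₑ ∂P = ‖c p‖ₑ * ∫⁻ x, ‖x‖ₑ ∂laplaceMeasure := by
        intro p
        simp_rw [enorm_mul]
        rw [lintegral_const_mul _ (by fun_prop)]
        congr 1
        exact (hmp p).lintegral_comp (by fun_prop)
      simp_rw [e]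
      rw [ENNReal.tsum_mul_right]
      refine ENNReal.mul_ne_top ?_ h1
      simpa only [← ofReal_norm, Real.norm_eq_abs] using hc.tsum_ofReal_ne_top
    filter_upwards
      [ae_lt_top' (AEMeasurable.tsum fun p => (hcm p).enorm.aemeasurable) h2] with w hw
    exact (tsum_enorm_ne_top_iff_summable_norm.1 hw.ne).of_norm.hasSum.tendsto_sum_nat
  have hXm : AEMeasurable X P := aemeasurable_of_tendsto_metrizable_ae _
    (fun n => (hSm n).aemeasurable) hlim
  have hind : iIndepFun (fun p (w : ℕ → ℝ) => w p) P :=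
    iIndepFun_infinitePi (X := fun _ x => x) fun _ => measurable_id
  refine ⟨P.map X, Measure.isProbabilityMeasure_map hXm, ?_, ?_⟩
  · set T := ∑' p, |c p| with hT
    have hT0 : 0 ≤ T := tsum_nonneg fun _ => abs_nonneg _
    -- This gives `a |c p| ≤ 1 / 2` for all `p`, the range where `1 / (1 - u) ≤ 1 + 2 u ≤ exp (2
    -- u)`.
    set a : ℝ := 1 / (2 * (1 + T)) with ha
    have a0 : 0 < a := by positivity
    have hac : ∀ p, a * |c p| ≤ 1 / 2 := by
      intro p
      have : |c p| ≤ T := hc.le_tsum p fun _ _ => abs_nonneg _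
      rw [ha, one_div, inv_mul_le_iff₀ (by positivity)]
      linarith
    refine ⟨a, a0, ?_⟩
    have hSn : ∀ n, ∫⁻ w, ENNReal.ofReal (Real.exp (a * |S n w|)) ∂P ≤
        ENNReal.ofReal (Real.exp (2 * a * T)) := by
      intro n
      calc ∫⁻ w, ENNReal.ofReal (Real.exp (a * |S n w|)) ∂P
          ≤ ∫⁻ w, ∏ p ∈ Finset.range n,
              ENNReal.ofReal (Real.exp (a * |c p| * |w p|)) ∂P := by
            refine lintegral_mono fun w => ?_
            rw [← ENNReal.ofReal_prod_of_nonneg fun _ _ => by positivity, ← Real.exp_sum]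
            refine ENNReal.ofReal_le_ofReal (Real.exp_le_exp.2 ?_)
            simp_rw [mul_assoc]
            rw [← Finset.mul_sum]
            gcongr
            refine (Finset.abs_sum_le_sum_abs _ _).trans (le_of_eq ?_)
            simp_rw [abs_mul]
        _ = ∏ p ∈ Finset.range n, ∫⁻ w, ENNReal.ofReal (Real.exp (a * |c p| * |w p|)) ∂P := by
            refine lintegral_prod_eq_prod_lintegral_of_indepFun _
              (fun p (w : ℕ → ℝ) => ENNReal.ofReal (Real.exp (a * |c p| * |w p|))) ?_
              fun p => by fun_prop
            exact hind.comp (fun p x => ENNReal.ofReal (Real.exp (a * |c p| * |x|)))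
              fun p => by fun_prop
        _ = ∏ p ∈ Finset.range n, ENNReal.ofReal (1 / (1 - a * |c p|)) := by
            refine Finset.prod_congr rfl fun p _ => ?_
            rw [← lintegral_exp_mul_abs_laplaceMeasure (by linarith [hac p])]
            exact (hmp p).lintegral_comp
              (f := fun x => ENNReal.ofReal (Real.exp (a * |c p| * |x|))) (by fun_prop)
        _ ≤ ∏ p ∈ Finset.range n, ENNReal.ofReal (Real.exp (2 * a * |c p|)) := by
            refine Finset.prod_le_prod' fun p _ => ENNReal.ofReal_le_ofReal ?_
            have h0 : 0 ≤ a * |c p| := by positivity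
            have := hac p
            refine le_trans ?_ (Real.add_one_le_exp _)
            rw [div_le_iff₀ (by linarith)]
            nlinarith
        _ ≤ ENNReal.ofReal (Real.exp (2 * a * T)) := by
            rw [← ENNReal.ofReal_prod_of_nonneg fun _ _ => by positivity, ← Real.exp_sum,
              ← Finset.mul_sum]
            refine ENNReal.ofReal_le_ofReal (Real.exp_le_exp.2 ?_)
            gcongr
            exact hc.sum_le_tsum _ fun _ _ => abs_nonneg _
    rw [integrable_map_measure (by fun_prop) hXm]
    refine ⟨(AEMeasurable.aestronglyMeasurable (by fun_prop)), ?_⟩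
    rw [hasFiniteIntegral_iff_ofReal (ae_of_all _ fun _ => by
      simp only [Function.comp_apply, Pi.zero_apply]; positivity)]
    refine lt_of_le_of_lt ?_ (ENNReal.ofReal_lt_top (r := Real.exp (2 * a * T)))
    -- Fatou's lemma carries the bound, uniform in `n`, from the partial sums to the limit.
    have e : ∀ᵐ w ∂P, ENNReal.ofReal (((fun x => Real.exp (a * |x|)) ∘ X) w) =
        liminf (fun n => ENNReal.ofReal (Real.exp (a * |S n w|))) atTop := by
      filter_upwards [hlim] with w hw
      refine (Tendsto.liminf_eq ?_).symm
      have hcont : Continuous fun x : ℝ => ENNReal.ofReal (Real.exp (a * |x|)) :=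
        ENNReal.continuous_ofReal.comp (by fun_prop)
      exact (hcont.tendsto _).comp hw
    rw [lintegral_congr_ae e]
    refine (lintegral_liminf_le fun n => by fun_prop).trans ?_
    exact liminf_le_of_le (by isBoundedDefault) fun b hb => by
      obtain ⟨n, hn⟩ := hb.exists
      exact hn.trans (hSn n)
  · intro t
    have e : ∀ n, ∫ w, Complex.exp (t * S n w * Complex.I) ∂P =
        ∏ p ∈ Finset.range n, (1 + ((c p : ℂ) * t) ^ 2)⁻¹ := by
      intro n
      have h1 : charFun (P.map (S n)) t = ∫ w, Complex.exp (t * S n w * Complex.I) ∂P := by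
        rw [charFun_apply_real, integral_map (hSm n).aemeasurable (by fun_prop)]
      have hind' : iIndepFun (fun p (w : ℕ → ℝ) => c p * w p) P :=
        hind.comp (fun p x => c p * x) fun p => by fun_prop
      rw [← h1, hS]
      simp only
      rw [iIndepFun.charFun_map_fun_finsetSum_eq_prod (X := fun p (w : ℕ → ℝ) => c p * w p)
        (fun p _ => (hcm p).aemeasurable) (hind'.restrict _), Finset.prod_apply]
      refine Finset.prod_congr rfl fun p _ => ?_
      rw [charFun_map_mul_comp (measurable_pi_apply p).aemeasurable, (hmp p).map_eq,
        charFun_laplaceMeasure]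
      push_cast
      rfl
    simp_rw [← e]
    rw [charFun_apply_real, integral_map hXm (by fun_prop)]
    refine tendsto_integral_of_dominated_convergence (fun _ => 1) (fun n => by fun_prop)
      (integrable_const _) (fun n => ae_of_all _ fun w => ?_) ?_
    · rw [← Complex.ofReal_mul, Complex.norm_exp_ofReal_mul_I]
    · filter_upwards [hlim] with w hw
      have hcont : Continuous fun x : ℝ => Complex.exp (t * x * Complex.I) := by fun_prop
      exact (hcont.tendsto _).comp hw

end LaplaceSeries

/-- A sequence of functions, each the derivative of its predecessor, is the sequence of iterated
derivatives of its first member. -/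
lemma contDiff_and_iteratedDeriv_of_hasDerivAt_succ {F : ℕ → ℝ → ℂ}
    (hF : ∀ n x, HasDerivAt (F n) (F (n + 1) x) x) :
    ContDiff ℝ ∞ (F 0) ∧ ∀ n, iteratedDeriv n (F 0) = F n := by
  have h : ∀ n, iteratedDeriv n (F 0) = F n := by
    intro n
    induction n with
    | zero => exact iteratedDeriv_zero
    | succ n ih =>
      rw [iteratedDeriv_succ, ih]
      funext x
      exact (hF n x).deriv
  refine ⟨contDiff_of_differentiable_iteratedDeriv fun n _ => ?_, h⟩
  rw [h]
  exact fun x => (hF n x).differentiableAt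

/-! ### Pointwise estimates in the step spaces. -/

namespace UltraTest

variable {M : ℕ → ℝ} {h : ℝ} {φ : ℝ → ℂ}

lemma weighted_le_iff (hM : IsWeightSequence M) (hh : 0 < h) {C : ℝ} (α β : ℕ) (x : ℝ) :
    weighted M h φ (α, β, x) ≤ C ↔
      |x| ^ β * ‖iteratedDeriv α φ x‖ ≤ C * (M α * M β / h ^ (α + β)) := by
  have h1 := mul_pos (hM.pos α) (hM.pos β)
  have h2 : 0 < h ^ (α + β) := pow_pos hh _
  have e : weighted M h φ (α, β, x) =
      |x| ^ β * ‖iteratedDeriv α φ x‖ / (M α * M β / h ^ (α + β)) := by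
    simp only [weighted]
    rw [abs_div, abs_mul, abs_of_pos h1, abs_of_pos h2, abs_pow]
    field_simp
  rw [e, div_le_iff₀ (div_pos h1 h2)]

lemma iSup_weighted_nonneg (M : ℕ → ℝ) (h : ℝ) (φ : ℝ → ℂ) : 0 ≤ ⨆ i, weighted M h φ i :=
  Real.iSup_nonneg fun i => weighted_nonneg M h φ i

lemma pow_mul_norm_iteratedDeriv_le (hM : IsWeightSequence M) (hh : 0 < h)
    (hφ : φ ∈ stepSubmodule M h) (α β : ℕ) (x : ℝ) :
    |x| ^ β * ‖iteratedDeriv α φ x‖ ≤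
      (⨆ i, weighted M h φ i) * (M α * M β / h ^ (α + β)) :=
  (weighted_le_iff hM hh α β x).1 (le_ciSup hφ.2 (α, β, x))

lemma norm_iteratedDeriv_le (hM : IsWeightSequence M) (hh : 0 < h)
    (hφ : φ ∈ stepSubmodule M h) (α : ℕ) (x : ℝ) :
    ‖iteratedDeriv α φ x‖ ≤ (⨆ i, weighted M h φ i) * (M α * M 0 / h ^ α) := by
  simpa using pow_mul_norm_iteratedDeriv_le hM hh hφ α 0 x

lemma hasDerivAt_iteratedDeriv (hφ : ContDiff ℝ ∞ φ) (n : ℕ) (x : ℝ) :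
    HasDerivAt (iteratedDeriv n φ) (iteratedDeriv (n + 1) φ x) x := by
  rw [iteratedDeriv_succ]
  exact ((hφ.differentiable_iteratedDeriv n (by exact_mod_cast ENat.natCast_lt_top n)) x).hasDerivAt

lemma continuous_iteratedDeriv_of_smooth (hφ : ContDiff ℝ ∞ φ) (n : ℕ) :
    Continuous (iteratedDeriv n φ) :=
  continuous_iff_continuousAt.2 fun x => (hasDerivAt_iteratedDeriv hφ n x).continuousAt

/-- Adding the bounds for `β = 0` and `β = 2` gives a majorant integrable in `x` that keeps the
growth `M_α / h^α`. -/
lemma norm_iteratedDeriv_le_inv_one_add_sq (hM : IsWeightSequence M) (hh : 0 < h)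
    (hφ : φ ∈ stepSubmodule M h) (α : ℕ) (x : ℝ) :
    ‖iteratedDeriv α φ x‖ ≤
      ((⨆ i, weighted M h φ i) * (M 0 + M 2 / h ^ 2)) * (M α / h ^ α) * (1 + x ^ 2)⁻¹ := by
  have h0 := pow_mul_norm_iteratedDeriv_le hM hh hφ α 0 x
  have h2 := pow_mul_norm_iteratedDeriv_le hM hh hφ α 2 x
  rw [← div_eq_mul_inv, le_div_iff₀ (by positivity)]
  rw [sq_abs] at h2
  have e : (⨆ i, weighted M h φ i) * (M α * M 0 / h ^ (α + 0)) +
      (⨆ i, weighted M h φ i) * (M α * M 2 / h ^ (α + 2)) =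
      (⨆ i, weighted M h φ i) * (M 0 + M 2 / h ^ 2) * (M α / h ^ α) := by
    rw [add_zero, pow_add]; field_simp
  rw [← e]
  rw [pow_zero, one_mul] at h0
  linarith

lemma integrable_iteratedDeriv (hM : IsWeightSequence M) (hh : 0 < h)
    (hφ : φ ∈ stepSubmodule M h) (α : ℕ) : MeasureTheory.Integrable (iteratedDeriv α φ) :=
  (integrable_inv_one_add_sq.const_mul _).mono'
    (continuous_iteratedDeriv_of_smooth hφ.1 α).aestronglyMeasurable
    (MeasureTheory.ae_of_all _ (norm_iteratedDeriv_le_inv_one_add_sq hM hh hφ α))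

end UltraTest

/-- The differential operator of infinite order `∑ bₚ (d/dt)ᵖ`. -/
noncomputable def infiniteOrderOp (b : ℕ → ℂ) (φ : ℝ → ℂ) (t : ℝ) : ℂ :=
  ∑' p, b p * iteratedDeriv p φ t

namespace UltraTest

/-! ### Differential operators of infinite order on the step spaces. -/

section InfiniteOrder

variable {M : ℕ → ℝ} {h H C : ℝ} {φ : ℝ → ℂ} {b : ℕ → ℂ}

/-- The factor `(h / 2) ^ p` from `hb` meets `h ^ (-p)` from the seminorm and leaves a geometric
series; the factor `H ^ α` is paid for by passing from `h` to `h / H`. -/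
lemma pow_mul_norm_term_le (hM : IsWeightSequence M) (hH : 1 ≤ H) (hh : 0 < h) (hC : 0 ≤ C)
    (hb : ∀ p α, ‖b p‖ * M (p + α) ≤ C * (h / 2) ^ p * (H ^ α * M α))
    (hφ : φ ∈ stepSubmodule M h) (p α β : ℕ) (x : ℝ) :
    |x| ^ β * ‖b p * iteratedDeriv (p + α) φ x‖ ≤
      (1 / 2) ^ p * (C * (⨆ i, weighted M h φ i) * (M α * M β / (h / H) ^ (α + β))) := by
  set N := ⨆ i, weighted M h φ i with hN
  have hN0 : 0 ≤ N := iSup_weighted_nonneg M h φ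
  have h1 := pow_mul_norm_iteratedDeriv_le hM hh hφ (p + α) β x
  have hα := hM.pos α
  have hβ := hM.pos β
  have hH0 : 0 < H := one_pos.trans_le hH
  rw [norm_mul]
  calc |x| ^ β * (‖b p‖ * ‖iteratedDeriv (p + α) φ x‖)
      = ‖b p‖ * (|x| ^ β * ‖iteratedDeriv (p + α) φ x‖) := by ring
    _ ≤ ‖b p‖ * (N * (M (p + α) * M β / h ^ (p + α + β))) := by gcongr
    _ = (‖b p‖ * M (p + α)) * (N * (M β / h ^ (p + α + β))) := by ring
    _ ≤ (C * (h / 2) ^ p * (H ^ α * M α)) * (N * (M β / h ^ (p + α + β))) := by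
        have := hb p α
        gcongr
    _ = (1 / 2) ^ p * (C * N * (H ^ α * (M α * M β / h ^ (α + β)))) := by
        rw [add_assoc, pow_add h, div_pow, div_pow, one_pow]
        field_simp
    _ ≤ (1 / 2) ^ p * (C * N * (H ^ (α + β) * (M α * M β / h ^ (α + β)))) := by
        have : H ^ α ≤ H ^ (α + β) := pow_le_pow_right₀ hH (Nat.le_add_right _ _)
        gcongr
    _ = _ := by
        have e : (h / H) ^ (α + β) = h ^ (α + β) / H ^ (α + β) := div_pow _ _ _
        rw [e]
        field_simp

lemma summable_mul_iteratedDeriv (hM : IsWeightSequence M) (hH : 1 ≤ H) (hh : 0 < h)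
    (hC : 0 ≤ C) (hb : ∀ p α, ‖b p‖ * M (p + α) ≤ C * (h / 2) ^ p * (H ^ α * M α))
    (hφ : φ ∈ stepSubmodule M h) (α : ℕ) (x : ℝ) :
    Summable fun p => b p * iteratedDeriv (p + α) φ x :=
  Summable.of_norm_bounded (summable_geometric_two.mul_right _) fun p => by
    simpa only [pow_zero, one_mul] using pow_mul_norm_term_le hM hH hh hC hb hφ p α 0 x

lemma hasSum_infiniteOrderOp (hM : IsWeightSequence M) (hH : 1 ≤ H) (hh : 0 < h)
    (hC : 0 ≤ C) (hb : ∀ p α, ‖b p‖ * M (p + α) ≤ C * (h / 2) ^ p * (H ^ α * M α))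
    (hφ : φ ∈ stepSubmodule M h) (x : ℝ) :
    HasSum (fun p => b p * iteratedDeriv p φ x) (infiniteOrderOp b φ x) :=
  (summable_mul_iteratedDeriv hM hH hh hC hb hφ 0 x).hasSum

lemma infiniteOrderOp_mem_and_le (hM : IsWeightSequence M) (hH : 1 ≤ H) (hh : 0 < h)
    (hC : 0 ≤ C) (hb : ∀ p α, ‖b p‖ * M (p + α) ≤ C * (h / 2) ^ p * (H ^ α * M α))
    (hφ : φ ∈ stepSubmodule M h) :
    infiniteOrderOp b φ ∈ stepSubmodule M (h / H) ∧
      ∀ i, weighted M (h / H) (infiniteOrderOp b φ) i ≤ 2 * C * ⨆ i, weighted M h φ i := by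
  have hd : ∀ α x, HasDerivAt (fun t => ∑' p, b p * iteratedDeriv (p + α) φ t)
      (∑' p, b p * iteratedDeriv (p + (α + 1)) φ x) x := by
    intro α x
    refine hasDerivAt_tsum (y₀ := x) (u := fun p => (1 / 2) ^ p *
      (C * (⨆ i, weighted M h φ i) * (M (α + 1) * M 0 / (h / H) ^ (α + 1 + 0))))
      (summable_geometric_two.mul_right _)
      (fun p y => (hasDerivAt_iteratedDeriv hφ.1 (p + α) y).const_mul (b p)) (fun p y => ?_)
      (summable_mul_iteratedDeriv hM hH hh hC hb hφ α x) x
    simpa only [pow_zero, one_mul, ← add_assoc] using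
      pow_mul_norm_term_le hM hH hh hC hb hφ p (α + 1) 0 y
  obtain ⟨hs, hi⟩ := contDiff_and_iteratedDeriv_of_hasDerivAt_succ hd
  have e : infiniteOrderOp b φ = fun t => ∑' p, b p * iteratedDeriv (p + 0) φ t := rfl
  have hbd : ∀ i, weighted M (h / H) (infiniteOrderOp b φ) i ≤
      2 * C * ⨆ i, weighted M h φ i := by
    rintro ⟨α, β, x⟩
    rw [weighted_le_iff hM (div_pos hh (one_pos.trans_le hH)), e, hi]
    have e1 : |x| ^ β * ‖∑' p, b p * iteratedDeriv (p + α) φ x‖ =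
        ‖∑' p, |x| ^ β • (b p * iteratedDeriv (p + α) φ x)‖ := by
      rw [tsum_const_smul'', norm_smul, Real.norm_of_nonneg (by positivity)]
    rw [e1]
    refine (tsum_of_norm_bounded (hasSum_geometric_two.mul_right
      (C * (⨆ i, weighted M h φ i) * (M α * M β / (h / H) ^ (α + β)))) fun p => ?_).trans
      (le_of_eq ?_)
    · rw [norm_smul, Real.norm_of_nonneg (by positivity)]
      exact pow_mul_norm_term_le hM hH hh hC hb hφ p α β x
    · ring
  exact ⟨⟨e ▸ hs, _, Set.forall_mem_range.2 hbd⟩, hbd⟩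

/-- Coefficient bounds for the operators `P(i d/dt)`. -/
lemma exists_symbolCoeff_mul_le (hM : IsWeightSequence M) :
    ∃ H K : ℝ, 1 ≤ H ∧ 0 < K ∧ ∀ (L : ℕ → ℝ) (t h : ℝ), 0 < t →
      (∀ᶠ q in atTop, |L q| * t ≤ 1) → K ≤ t * h → ∃ C : ℝ, 0 ≤ C ∧ ∀ p α,
        ‖symbolCoeff M L p * Complex.I ^ p‖ * M (p + α) ≤ C * (h / 2) ^ p * (H ^ α * M α) := by
  obtain ⟨A, H, hA, hH, h2⟩ := hM.exists_stability
  obtain ⟨K, hK, hc⟩ := exists_symbolCoeff_le hM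
  have hH0 : 0 < H := one_pos.trans_le hH
  -- The threshold `2 H K ≤ t h` says exactly that `(K / t) H ≤ h / 2`, where `H` comes from
  -- splitting `M (p + α)` by (M.2).
  refine ⟨H, 2 * H * K, hH, by positivity, fun L t h ht hL hth => ?_⟩
  obtain ⟨C, hC, hCp⟩ := hc L t ht hL
  refine ⟨C * A, by positivity, fun p α => ?_⟩
  have hp := hM.pos p
  have hα := hM.pos α
  have hr : K / t * H ≤ h / 2 := by
    rw [div_mul_eq_mul_div, div_le_iff₀ ht]; linarith
  rw [norm_mul, norm_pow, Complex.norm_I, one_pow, mul_one]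
  calc ‖symbolCoeff M L p‖ * M (p + α)
      ≤ (C * (K / t) ^ p / M p) * (A * H ^ (p + α) * (M p * M α)) :=
        mul_le_mul (hCp p) (h2 p α) (hM.pos _).le (by positivity)
    _ = C * A * (K / t * H) ^ p * (H ^ α * M α) := by rw [mul_pow, pow_add]; field_simp
    _ ≤ C * A * (h / 2) ^ p * (H ^ α * M α) := by gcongr

end InfiniteOrder

end UltraTest

open MeasureTheory in
/-- The convolution of a function with a measure on the real line. -/
noncomputable def measureConv (μ : Measure ℝ) (φ : ℝ → ℂ) (x : ℝ) : ℂ := ∫ y, φ (x - y) ∂μ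

namespace UltraTest

open MeasureTheory

/-! ### Convolution with a measure having an exponential moment. -/

section Convolution

variable {M : ℕ → ℝ} {h : ℝ} {φ : ℝ → ℂ} {μ : Measure ℝ}

lemma integrable_comp_sub_of_bounded [IsFiniteMeasure μ] {f : ℝ → ℂ} (hf : Continuous f) {B : ℝ}
    (hB : ∀ x, ‖f x‖ ≤ B) (x : ℝ) : Integrable (fun y => f (x - y)) μ :=
  (integrable_const B).mono' (by fun_prop) (ae_of_all _ fun y => hB _)

lemma integrable_iteratedDeriv_comp_sub [IsFiniteMeasure μ] (hM : IsWeightSequence M)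
    (hh : 0 < h) (hφ : φ ∈ stepSubmodule M h) (α : ℕ) (x : ℝ) :
    Integrable (fun y => iteratedDeriv α φ (x - y)) μ :=
  integrable_comp_sub_of_bounded (continuous_iteratedDeriv_of_smooth hφ.1 α)
    (norm_iteratedDeriv_le hM hh hφ α) x

lemma contDiff_and_iteratedDeriv_measureConv [IsFiniteMeasure μ] (hM : IsWeightSequence M)
    (hh : 0 < h) (hφ : φ ∈ stepSubmodule M h) :
    ContDiff ℝ ∞ (measureConv μ φ) ∧
      ∀ n, iteratedDeriv n (measureConv μ φ) = measureConv μ (iteratedDeriv n φ) := by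
  have hd : ∀ n x, HasDerivAt (measureConv μ (iteratedDeriv n φ))
      (measureConv μ (iteratedDeriv (n + 1) φ) x) x := by
    intro n x
    refine (hasDerivAt_integral_of_dominated_loc_of_deriv_le (s := Set.univ) univ_mem
      (Eventually.of_forall fun z =>
        (integrable_iteratedDeriv_comp_sub hM hh hφ n z).aestronglyMeasurable)
      (integrable_iteratedDeriv_comp_sub hM hh hφ n x)
      (integrable_iteratedDeriv_comp_sub hM hh hφ (n + 1) x).aestronglyMeasurable
      (ae_of_all _ fun y z _ => norm_iteratedDeriv_le hM hh hφ (n + 1) (z - y))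
      (integrable_const _) (ae_of_all _ fun y z _ => ?_)).2
    exact (hasDerivAt_iteratedDeriv hφ.1 n (z - y)).comp_sub_const z y
  have := contDiff_and_iteratedDeriv_of_hasDerivAt_succ hd
  simpa only [iteratedDeriv_zero] using this

/-- The exponential moment bounds the `n`-th absolute moment by a constant times `n! / aⁿ`, and `n!`
is `O((a / h)ⁿ M_n)`. -/
lemma exists_moment_le [IsFiniteMeasure μ] (hM : IsWeightSequence M) {a : ℝ} (ha : 0 < a)
    (hμ : Integrable (fun x => Real.exp (a * |x|)) μ) (hh : 0 < h) :
    ∃ C : ℝ, 0 < C ∧ ∀ n : ℕ, Integrable (fun x => |x| ^ n) μ ∧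
      ∫ x, |x| ^ n ∂μ ≤ C * (M n / h ^ n) := by
  obtain ⟨C, hC, hCn⟩ := hM.exists_factorial_le (div_pos ha hh)
  set E := ∫ x, Real.exp (a * |x|) ∂μ with hE
  have hE0 : 0 ≤ E := integral_nonneg fun _ => (Real.exp_pos _).le
  refine ⟨C * (E + 1), by positivity, fun n => ?_⟩
  have hle : ∀ x : ℝ, |x| ^ n ≤ n.factorial / a ^ n * Real.exp (a * |x|) := by
    intro x
    have := Real.pow_div_factorial_le_exp (a * |x|) (by positivity) n
    rw [div_le_iff₀ (by positivity), mul_pow] at this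
    rw [div_mul_eq_mul_div, le_div_iff₀ (by positivity)]
    linarith
  have hint : Integrable (fun x => |x| ^ n) μ :=
    (hμ.const_mul _).mono' (by fun_prop) (ae_of_all _ fun x => by
      rw [Real.norm_of_nonneg (by positivity)]; exact hle x)
  refine ⟨hint, ?_⟩
  have hn := hM.pos n
  calc ∫ x, |x| ^ n ∂μ ≤ ∫ x, n.factorial / a ^ n * Real.exp (a * |x|) ∂μ :=
        integral_mono hint (hμ.const_mul _) hle
    _ = n.factorial / a ^ n * E := integral_const_mul _ _
    _ ≤ (C * ((a / h) ^ n * M n)) / a ^ n * (E + 1) := by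
        gcongr
        · exact hCn n
        · linarith
    _ = _ := by rw [div_pow]; field_simp

/-- The inequality `|x|^β ≤ 2^β (|x - y|^β + |y|^β)` splits the weight between the decay of `φ` and
the moments of `μ`; the factor `2^β` costs the passage from `h` to `h / 2`. -/
lemma measureConv_mem [IsFiniteMeasure μ] (hM : IsWeightSequence M) {a : ℝ}
    (ha : 0 < a) (hμ : Integrable (fun x => Real.exp (a * |x|)) μ) (hh : 0 < h)
    (hφ : φ ∈ stepSubmodule M h) : measureConv μ φ ∈ stepSubmodule M (h / 2) := by
  obtain ⟨C, hC, hCn⟩ := exists_moment_le hM ha hμ hh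
  obtain ⟨hs, hi⟩ := contDiff_and_iteratedDeriv_measureConv (μ := μ) hM hh hφ
  set N := ⨆ i, weighted M h φ i with hN
  have hN0 : 0 ≤ N := iSup_weighted_nonneg M h φ
  refine ⟨hs, N * (μ.real Set.univ + M 0 * C), ?_⟩
  rintro _ ⟨⟨α, β, x⟩, rfl⟩
  rw [weighted_le_iff hM (half_pos hh), hi]
  have hα := hM.pos α
  have hβ := hM.pos β
  have h0 := hM.pos 0
  have hpt : ∀ y, |x| ^ β * ‖iteratedDeriv α φ (x - y)‖ ≤
      2 ^ β * (N * (M α * M β / h ^ (α + β)) + N * (M α * M 0 / h ^ α) * |y| ^ β) := by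
    intro y
    have h1 : |x| ^ β ≤ 2 ^ β * (|x - y| ^ β + |y| ^ β) := by
      have h2 : |x| ≤ 2 * max |x - y| |y| := by
        have : |x| ≤ |x - y| + |y| := by simpa using abs_add_le (x - y) y
        have := le_max_left |x - y| |y|
        have := le_max_right |x - y| |y|
        linarith
      calc |x| ^ β ≤ (2 * max |x - y| |y|) ^ β := by gcongr
        _ = 2 ^ β * max |x - y| |y| ^ β := mul_pow _ _ _
        _ ≤ _ := by
          gcongr
          rcases max_choice |x - y| |y| with h | h <;> rw [h] <;>
          linarith [pow_nonneg (abs_nonneg y) β, pow_nonneg (abs_nonneg (x - y)) β]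
    have h3 := pow_mul_norm_iteratedDeriv_le hM hh hφ α β (x - y)
    have h4 := mul_le_mul_of_nonneg_right (norm_iteratedDeriv_le hM hh hφ α (x - y))
      (pow_nonneg (abs_nonneg y) β)
    calc |x| ^ β * ‖iteratedDeriv α φ (x - y)‖
        ≤ 2 ^ β * (|x - y| ^ β + |y| ^ β) * ‖iteratedDeriv α φ (x - y)‖ := by gcongr
      _ = 2 ^ β * (|x - y| ^ β * ‖iteratedDeriv α φ (x - y)‖ +
          ‖iteratedDeriv α φ (x - y)‖ * |y| ^ β) := by ring
      _ ≤ _ := by gcongr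
  have hm := hCn β
  calc |x| ^ β * ‖measureConv μ (iteratedDeriv α φ) x‖
      ≤ |x| ^ β * ∫ y, ‖iteratedDeriv α φ (x - y)‖ ∂μ := by
        gcongr
        exact norm_integral_le_integral_norm _
    _ = ∫ y, |x| ^ β * ‖iteratedDeriv α φ (x - y)‖ ∂μ := (integral_const_mul _ _).symm
    _ ≤ ∫ y, 2 ^ β * (N * (M α * M β / h ^ (α + β)) +
          N * (M α * M 0 / h ^ α) * |y| ^ β) ∂μ :=
        integral_mono ((integrable_iteratedDeriv_comp_sub hM hh hφ α x).norm.const_mul _)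
          (((integrable_const _).add (hm.1.const_mul _)).const_mul _) hpt
    _ = 2 ^ β * (μ.real Set.univ * (N * (M α * M β / h ^ (α + β))) +
          N * (M α * M 0 / h ^ α) * ∫ y, |y| ^ β ∂μ) := by
        rw [integral_const_mul, integral_add (integrable_const _) (hm.1.const_mul _),
          integral_const, integral_const_mul, smul_eq_mul]
    _ ≤ 2 ^ (α + β) * (μ.real Set.univ * (N * (M α * M β / h ^ (α + β))) +
          N * (M α * M 0 / h ^ α) * (C * (M β / h ^ β))) := by
        have : (2 : ℝ) ^ β ≤ 2 ^ (α + β) := pow_le_pow_right₀ one_le_two (Nat.le_add_left _ _)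
        have := hm.2
        gcongr
    _ = _ := by
        have e : (h / 2) ^ (α + β) = h ^ (α + β) / 2 ^ (α + β) := div_pow _ _ _
        rw [e, pow_add h]
        field_simp

end Convolution

/-! ### Convolution commutes with the operator. -/

section Commutation

variable {M : ℕ → ℝ} {h H C : ℝ} {φ : ℝ → ℂ} {b : ℕ → ℂ} {μ : Measure ℝ}

/-- Sum and integral may be exchanged because the terms have a geometric majorant constant in `y`,
integrable against a finite measure. -/
lemma hasSum_mul_iteratedDeriv_measureConv [IsFiniteMeasure μ] (hM : IsWeightSequence M)
    (hH : 1 ≤ H) (hh : 0 < h) (hC : 0 ≤ C)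
    (hb : ∀ p α, ‖b p‖ * M (p + α) ≤ C * (h / 2) ^ p * (H ^ α * M α))
    (hφ : φ ∈ stepSubmodule M h) (x : ℝ) :
    HasSum (fun p => b p * iteratedDeriv p (measureConv μ φ) x)
      (measureConv μ (infiniteOrderOp b φ) x) := by
  obtain ⟨-, hi⟩ := contDiff_and_iteratedDeriv_measureConv (μ := μ) hM hh hφ
  simp_rw [hi, measureConv, ← integral_const_mul]
  set D := C * (⨆ i, weighted M h φ i) * (M 0 * M 0 / (h / H) ^ (0 + 0)) with hD
  have hterm : ∀ p y, ‖b p * iteratedDeriv p φ y‖ ≤ (1 / 2) ^ p * D := fun p y => by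
    have := pow_mul_norm_term_le hM hH hh hC hb hφ p 0 0 y
    rw [pow_zero, one_mul] at this
    exact this
  refine hasSum_integral_of_summable_integral_norm
    (F := fun p y => b p * iteratedDeriv p φ (x - y))
    (fun p => (integrable_iteratedDeriv_comp_sub hM hh hφ p x).const_mul _) ?_
  refine Summable.of_nonneg_of_le (fun p => integral_nonneg fun _ => norm_nonneg _) (fun p => ?_)
    ((summable_geometric_two.mul_right D).mul_left (μ.real Set.univ))
  calc ∫ y, ‖b p * iteratedDeriv p φ (x - y)‖ ∂μ ≤ ∫ _, (1 / 2) ^ p * D ∂μ :=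
        integral_mono ((integrable_iteratedDeriv_comp_sub hM hh hφ p x).const_mul _).norm
          (integrable_const _) fun y => hterm p (x - y)
    _ = _ := by rw [integral_const, smul_eq_mul]

end Commutation

end UltraTest

/-! ### Fourier transforms of convolutions and of the operator. -/

section Fourier

open MeasureTheory FourierTransform

variable {μ : Measure ℝ} {f g : ℝ → ℂ}

lemma norm_fourierPhase (x ξ : ℝ) : ‖Complex.exp (↑(-2 * Real.pi * x * ξ) * Complex.I)‖ = 1 :=
  Complex.norm_exp_ofReal_mul_I _

lemma integrable_fourierPhase_mul (hf : Integrable f) (ξ : ℝ) :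
    Integrable fun x : ℝ => Complex.exp (↑(-2 * Real.pi * x * ξ) * Complex.I) * f x :=
  hf.bdd_mul (c := 1) (by fun_prop) (ae_of_all _ fun x => (norm_fourierPhase x ξ).le)

/-- Fourier inversion is applied to `f - g`: its transform vanishes, so the integrability that
inversion requires is automatic. -/
lemma eq_of_fourier_eq (hf : Integrable f) (hg : Integrable g) (hfc : Continuous f)
    (hgc : Continuous g) (h : 𝓕 f = 𝓕 g) : f = g := by
  have hs : 𝓕 (fun x => f x - g x) = 0 := by
    funext ξ
    have := congrFun h ξ
    simp only [Real.fourier_real_eq_integral_exp_smul, smul_eq_mul] at this ⊢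
    simp only [mul_sub]
    rw [integral_sub (integrable_fourierPhase_mul hf ξ) (integrable_fourierPhase_mul hg ξ), this,
      sub_self, Pi.zero_apply]
  have hinv := (hfc.sub hgc).fourierInv_fourier_eq (hf.sub hg)
    (by rw [show f - g = fun x => f x - g x from rfl, hs]; exact integrable_zero _ _ _)
  rw [show f - g = fun x => f x - g x from rfl, hs] at hinv
  funext x
  have := congrFun hinv x
  simp only [Real.fourierInv_eq', Pi.zero_apply, smul_zero, integral_zero] at this
  exact (sub_eq_zero.1 this.symm)

lemma integrable_prod_comp_sub [IsFiniteMeasure μ] (hf : Integrable f) (hfc : Continuous f) :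
    Integrable (fun z : ℝ × ℝ => f (z.1 - z.2)) (volume.prod μ) := by
  rw [integrable_prod_iff' (by fun_prop)]
  refine ⟨ae_of_all _ fun y => hf.comp_sub_right y, ?_⟩
  have e : ∀ y, ∫ x, ‖f (x - y)‖ = ∫ x, ‖f x‖ := fun y =>
    integral_sub_right_eq_self (fun x => ‖f x‖) y
  simp only [e]
  exact integrable_const _

lemma integrable_measureConv [IsFiniteMeasure μ] (hf : Integrable f) (hfc : Continuous f) :
    Integrable (measureConv μ f) :=
  (integrable_prod_comp_sub hf hfc).integral_prod_left

/-- The Fourier transform turns convolution with a measure into multiplication by its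
characteristic function. -/
lemma fourier_measureConv [IsFiniteMeasure μ] (hf : Integrable f) (hfc : Continuous f) (ξ : ℝ) :
    𝓕 (measureConv μ f) ξ = charFun μ (-2 * Real.pi * ξ) * 𝓕 f ξ := by
  rw [Real.fourier_real_eq_integral_exp_smul, Real.fourier_real_eq_integral_exp_smul]
  simp only [measureConv, smul_eq_mul, ← integral_const_mul]
  have hint : Integrable (fun z : ℝ × ℝ =>
      Complex.exp (↑(-2 * Real.pi * z.1 * ξ) * Complex.I) * f (z.1 - z.2)) (volume.prod μ) :=
    (integrable_prod_comp_sub hf hfc).bdd_mul (c := 1) (by fun_prop)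
      (ae_of_all _ fun z => (norm_fourierPhase z.1 ξ).le)
  rw [integral_integral_swap hint, integral_const_mul, charFun_apply_real, ← integral_mul_const]
  refine integral_congr_ae (ae_of_all _ fun y => ?_)
  simp only
  rw [← integral_sub_right_eq_self
    (fun x : ℝ => Complex.exp (↑(-2 * Real.pi * x * ξ) * Complex.I) * f x) y,
    ← integral_const_mul]
  refine integral_congr_ae (ae_of_all _ fun x => ?_)
  simp only
  rw [← mul_assoc, ← Complex.exp_add]
  congr 2
  push_cast
  ring

end Fourier

namespace UltraTest

open MeasureTheory FourierTransform

variable {M : ℕ → ℝ} {h H C : ℝ} {φ : ℝ → ℂ} {b : ℕ → ℂ}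

/-- The integrals of the norms of the terms are dominated by a geometric series, which permits
transforming term by term. -/
lemma hasSum_fourier_infiniteOrderOp (hM : IsWeightSequence M) (hh : 0 < h)
    (hb : ∀ p α, ‖b p‖ * M (p + α) ≤ C * (h / 2) ^ p * (H ^ α * M α))
    (hφ : φ ∈ stepSubmodule M h) (ξ : ℝ) :
    HasSum (fun p => b p * (2 * Real.pi * Complex.I * ξ) ^ p * 𝓕 φ ξ)
      (𝓕 (infiniteOrderOp b φ) ξ) := by
  set D := (⨆ i, weighted M h φ i) * (M 0 + M 2 / h ^ 2) with hD
  have hD0 : 0 ≤ D := by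
    have := hM.pos 0
    have := hM.pos 2
    have := iSup_weighted_nonneg M h φ
    positivity
  have hint := fun p => integrable_iteratedDeriv hM hh hφ p
  have key := hasSum_integral_of_summable_integral_norm
    (F := fun p (x : ℝ) => Complex.exp (↑(-2 * Real.pi * x * ξ) * Complex.I) *
      (b p * iteratedDeriv p φ x)) (μ := volume)
    (fun p => integrable_fourierPhase_mul ((hint p).const_mul _) ξ) ?_
  · have e1 : ∀ p, ∫ x : ℝ, Complex.exp (↑(-2 * Real.pi * x * ξ) * Complex.I) *
        (b p * iteratedDeriv p φ x) = b p * (2 * Real.pi * Complex.I * ξ) ^ p * 𝓕 φ ξ := by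
      intro p
      have h1 := congrFun (Real.fourier_iteratedDeriv (N := ⊤) (n := p) (by exact hφ.1)
        (fun n _ => hint n) le_top) ξ
      rw [Real.fourier_real_eq_integral_exp_smul] at h1
      simp only [smul_eq_mul] at h1
      rw [mul_assoc, ← h1, ← integral_const_mul]
      refine integral_congr_ae (ae_of_all _ fun x => ?_)
      simp only
      ring
    have e2 : ∫ x : ℝ, ∑' p, Complex.exp (↑(-2 * Real.pi * x * ξ) * Complex.I) *
        (b p * iteratedDeriv p φ x) = 𝓕 (infiniteOrderOp b φ) ξ := by
      rw [Real.fourier_real_eq_integral_exp_smul]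
      simp only [tsum_mul_left, smul_eq_mul, infiniteOrderOp]
    rw [e2] at key
    simpa only [e1] using key
  · set I := ∫ x : ℝ, (1 + x ^ 2)⁻¹ with hI
    refine Summable.of_nonneg_of_le (fun p => integral_nonneg fun _ => norm_nonneg _)
      (fun p => ?_) (summable_geometric_two.mul_right (C * M 0 * D * I))
    have hI0 : 0 ≤ I := integral_nonneg fun x => by positivity
    calc ∫ x : ℝ, ‖Complex.exp (↑(-2 * Real.pi * x * ξ) * Complex.I) *
          (b p * iteratedDeriv p φ x)‖
        ≤ ∫ x : ℝ, ‖b p‖ * (D * (M p / h ^ p)) * (1 + x ^ 2)⁻¹ := by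
          refine integral_mono (integrable_fourierPhase_mul ((hint p).const_mul _) ξ).norm
            (integrable_inv_one_add_sq.const_mul _) fun x => ?_
          simp only
          rw [norm_mul, norm_fourierPhase, one_mul, norm_mul, mul_assoc]
          exact mul_le_mul_of_nonneg_left
            (norm_iteratedDeriv_le_inv_one_add_sq hM hh hφ p x) (norm_nonneg _)
      _ = (‖b p‖ * M (p + 0)) * (D / h ^ p * I) := by
          rw [integral_const_mul, add_zero]; ring
      _ ≤ (C * (h / 2) ^ p * (H ^ 0 * M 0)) * (D / h ^ p * I) := by
          have := hb p 0
          gcongr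
      _ = _ := by rw [div_pow, div_pow, one_pow]; field_simp

end UltraTest

/-! ### The inverse of the operator. -/

section Inversion

open MeasureTheory FourierTransform

variable {M L : ℕ → ℝ} {h H C : ℝ} {φ : ℝ → ℂ}

/-- The reciprocal of the symbol is the characteristic function of a measure with exponential
moments. -/
lemma exists_measure_charFun_mul_ultraSymbol (hM : IsWeightSequence M) {B : ℝ}
    (hB : ∀ q, |L q| ≤ B) :
    ∃ μ : Measure ℝ, IsProbabilityMeasure μ ∧
      (∃ a : ℝ, 0 < a ∧ Integrable (fun x => Real.exp (a * |x|)) μ) ∧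
      ∀ t : ℝ, charFun μ t * ultraSymbol M L t = 1 := by
  obtain ⟨μ, hμ, hexp, hchar⟩ := exists_measure_charFun_eq_prod (summable_abs_div_ratio hM hB)
  refine ⟨μ, hμ, hexp, fun t => ?_⟩
  refine tendsto_nhds_unique ((hchar t).mul (hasProd_symbolFactor hM hB t).tendsto_prod_nat) ?_
  -- At real `t` the factors `1 + (c t)²` are positive, so the partial products cancel exactly and
  -- no lower bound for the infinite product is needed.
  have e : ∀ n, (∏ p ∈ Finset.range n,
      (1 + (((L (p + 1) / (M (p + 1) / M p) : ℝ) : ℂ) * t) ^ 2)⁻¹) *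
      ∏ p ∈ Finset.range n, symbolFactor M L t p = 1 := by
    intro n
    rw [← Finset.prod_mul_distrib]
    refine Finset.prod_eq_one fun p _ => ?_
    have e1 : symbolFactor M L t p =
        ((1 + (L (p + 1) / (M (p + 1) / M p) * t) ^ 2 : ℝ) : ℂ) := by
      rw [symbolFactor_eq]; push_cast; ring
    have e2 : 1 + (((L (p + 1) / (M (p + 1) / M p) : ℝ) : ℂ) * t) ^ 2 =
        ((1 + (L (p + 1) / (M (p + 1) / M p) * t) ^ 2 : ℝ) : ℂ) := by
      push_cast; ring
    rw [e1, e2]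
    refine inv_mul_cancel₀ (Complex.ofReal_ne_zero.2 ?_)
    positivity
  simp only [e]
  exact tendsto_const_nhds

/-- Convolution with the measure whose characteristic function is `1 / P` inverts `P(i d/dt)`. -/
lemma measureConv_infiniteOrderOp {μ : Measure ℝ} [IsFiniteMeasure μ] (hM : IsWeightSequence M)
    (hP : SymbolExpands M L) (hμ : ∀ t : ℝ, charFun μ t * ultraSymbol M L t = 1)
    (hH : 1 ≤ H) (hh : 0 < h) (hC : 0 ≤ C)
    (hb : ∀ p α, ‖symbolCoeff M L p * Complex.I ^ p‖ * M (p + α) ≤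
      C * (h / 2) ^ p * (H ^ α * M α))
    (hφ : φ ∈ stepSubmodule M h) :
    measureConv μ (infiniteOrderOp (fun p => symbolCoeff M L p * Complex.I ^ p) φ) = φ := by
  have hψ := (infiniteOrderOp_mem_and_le hM hH hh hC hb hφ).1
  have hh' : 0 < h / H := div_pos hh (one_pos.trans_le hH)
  set ψ := infiniteOrderOp (fun p => symbolCoeff M L p * Complex.I ^ p) φ with hψd
  have hψi : Integrable ψ := by simpa using integrable_iteratedDeriv hM hh' hψ 0
  have hφi : Integrable φ := by simpa using integrable_iteratedDeriv hM hh hφ 0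
  refine eq_of_fourier_eq (integrable_measureConv hψi hψ.1.continuous) hφi
    (contDiff_and_iteratedDeriv_measureConv hM hh' hψ).1.continuous hφ.1.continuous ?_
  funext ξ
  rw [fourier_measureConv hψi hψ.1.continuous]
  have h1 : 𝓕 ψ ξ = ultraSymbol M L ((-2 * Real.pi * ξ : ℝ) : ℂ) * 𝓕 φ ξ := by
    refine (hasSum_fourier_infiniteOrderOp hM hh hb hφ ξ).unique ?_
    have h2 := (hP ((-2 * Real.pi * ξ : ℝ) : ℂ)).2.mul_right (𝓕 φ ξ)
    -- Since `i · 2πiξ = -2πξ`, the multiplier is the symbol at the same real point at which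
    -- `fourier_measureConv` evaluates the characteristic function.
    have e : ∀ p, symbolCoeff M L p * Complex.I ^ p * (2 * Real.pi * Complex.I * ξ) ^ p * 𝓕 φ ξ =
        symbolCoeff M L p * ((-2 * Real.pi * ξ : ℝ) : ℂ) ^ p * 𝓕 φ ξ := by
      intro p
      rw [mul_assoc (symbolCoeff M L p), ← mul_pow]
      congr 3
      push_cast
      linear_combination (2 * Real.pi * ξ : ℂ) * Complex.I_sq
    simpa only [e] using h2
  rw [h1, ← mul_assoc, hμ, one_mul]

end Inversion

/-! ### From bounded maps between step spaces to continuous maps between the limits. -/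

namespace UltraTest

variable {M : ℕ → ℝ}

lemma mem_stepSubmodule_of_le {h h' : ℝ} (h0 : 0 < h') (hh : h' ≤ h) {φ : ℝ → ℂ}
    (hφ : φ ∈ stepSubmodule M h) : φ ∈ stepSubmodule M h' := by
  obtain ⟨hs, C, hC⟩ := hφ
  refine ⟨hs, C, ?_⟩
  rintro _ ⟨i, rfl⟩
  exact (weighted_mono M h0 hh φ i).trans (hC ⟨i, rfl⟩)

lemma mem_beurlingSubmodule_iff {φ : ℝ → ℂ} :
    φ ∈ beurlingSubmodule M ↔ ∀ h : ℝ, 0 < h → φ ∈ stepSubmodule M h := by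
  simp only [beurlingSubmodule, Submodule.mem_iInf]

/-- `F` restricts to a bounded linear map from `S^{M_p,h}(ℝ)` to `S^{M_p,h'}(ℝ)`. -/
structure StepBounded (M : ℕ → ℝ) (F : (ℝ → ℂ) → ℝ → ℂ) (h h' : ℝ) : Prop where
  mem : ∀ φ ∈ stepSubmodule M h, F φ ∈ stepSubmodule M h'
  bound : ∃ C : ℝ, ∀ φ ∈ stepSubmodule M h, ∀ i,
    weighted M h' (F φ) i ≤ C * ⨆ i, weighted M h φ i
  map_add : ∀ φ ∈ stepSubmodule M h, ∀ ψ ∈ stepSubmodule M h, F (φ + ψ) = F φ + F ψ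
  map_smul : ∀ c : ℂ, ∀ φ ∈ stepSubmodule M h, F (c • φ) = c • F φ

namespace StepBounded

variable {F : (ℝ → ℂ) → ℝ → ℂ} {h h' k : ℝ}

lemma mono_right (hF : StepBounded M F h h') (hk : 0 < k) (hkh : k ≤ h') :
    StepBounded M F h k where
  mem φ hφ := mem_stepSubmodule_of_le hk hkh (hF.mem φ hφ)
  bound := by
    obtain ⟨C, hC⟩ := hF.bound
    exact ⟨C, fun φ hφ i => (weighted_mono M hk hkh _ i).trans (hC φ hφ i)⟩
  map_add := hF.map_add
  map_smul := hF.map_smul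

/-- The linear map between step spaces. -/
def toLinearMap (hF : StepBounded M F h h') : StepSpace M h →ₗ[ℂ] StepSpace M h' where
  toFun φ := ⟨F φ.1, hF.mem φ.1 φ.2⟩
  map_add' φ ψ := Subtype.ext (hF.map_add φ.1 φ.2 ψ.1 ψ.2)
  map_smul' c φ := Subtype.ext (hF.map_smul c φ.1 φ.2)

lemma continuous_toLinearMap (hF : StepBounded M F h h') : Continuous hF.toLinearMap := by
  obtain ⟨C, hC⟩ := hF.bound
  -- These structures induce the given topologies of the step spaces, so a norm bound yields
  -- continuity for them.
  let := (stepNorm M h).toAddGroupSeminorm.toSeminormedAddCommGroup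
  let := (stepNorm M h').toAddGroupSeminorm.toSeminormedAddCommGroup
  exact AddMonoidHomClass.continuous_of_bound hF.toLinearMap C fun φ =>
    ciSup_le fun i => hC φ.1 φ.2 i

end StepBounded

lemma stepBounded_infiniteOrderOp {h H C : ℝ} {b : ℕ → ℂ} (hM : IsWeightSequence M) (hH : 1 ≤ H)
    (hh : 0 < h) (hC : 0 ≤ C)
    (hb : ∀ p α, ‖b p‖ * M (p + α) ≤ C * (h / 2) ^ p * (H ^ α * M α)) :
    StepBounded M (infiniteOrderOp b) h (h / H) where
  mem φ hφ := (infiniteOrderOp_mem_and_le hM hH hh hC hb hφ).1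
  bound := ⟨2 * C, fun φ hφ => (infiniteOrderOp_mem_and_le hM hH hh hC hb hφ).2⟩
  map_add φ hφ ψ hψ := by
    funext x
    refine (hasSum_infiniteOrderOp hM hH hh hC hb (Submodule.add_mem _ hφ hψ) x).unique ?_
    have := (hasSum_infiniteOrderOp hM hH hh hC hb hφ x).add
      (hasSum_infiniteOrderOp hM hH hh hC hb hψ x)
    simp only [← mul_add] at this
    convert! this using 3 with p
    exact iteratedDeriv_add (hφ.1.contDiffAt.of_le (by exact_mod_cast le_top))
      (hψ.1.contDiffAt.of_le (by exact_mod_cast le_top))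
  map_smul c φ hφ := by
    funext x
    refine (hasSum_infiniteOrderOp hM hH hh hC hb (Submodule.smul_mem _ c hφ) x).unique ?_
    have := (hasSum_infiniteOrderOp hM hH hh hC hb hφ x).mul_left c
    simp only [mul_left_comm c] at this
    convert! this using 3 with p
    exact iteratedDeriv_const_smul (hφ.1.contDiffAt.of_le (by exact_mod_cast le_top)) c

end UltraTest

lemma BeurlingS.exists_continuousLinearMap {M : ℕ → ℝ} {F : (ℝ → ℂ) → ℝ → ℂ}
    (hF : ∀ h' : ℝ, 0 < h' → ∃ h : ℝ, 0 < h ∧ StepBounded M F h h') :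
    ∃ T : BeurlingS M →L[ℂ] BeurlingS M, ∀ φ : BeurlingS M, (T φ).1 = F φ.1 := by
  have hmem : ∀ φ ∈ beurlingSubmodule M, F φ ∈ beurlingSubmodule M := by
    intro φ hφ
    refine mem_beurlingSubmodule_iff.2 fun h' hh' => ?_
    obtain ⟨h, hh, hb⟩ := hF h' hh'
    exact hb.mem φ (mem_step_of_beurling hφ hh)
  -- Any single step suffices for linearity, since every Beurling function lies in all step spaces.
  obtain ⟨h₁, hh₁, hb₁⟩ := hF 1 one_pos
  refine ⟨⟨⟨⟨fun φ => ⟨F φ.1, hmem φ.1 φ.2⟩, fun φ ψ => Subtype.ext ?_⟩,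
    fun c φ => Subtype.ext ?_⟩, ?_⟩, fun φ => rfl⟩
  · exact hb₁.map_add _ (mem_step_of_beurling φ.2 hh₁) _ (mem_step_of_beurling ψ.2 hh₁)
  · exact hb₁.map_smul c _ (mem_step_of_beurling φ.2 hh₁)
  · refine continuous_iInf_rng.2 fun h' => continuous_iInf_rng.2 fun hh' => ?_
    refine continuous_induced_rng.2 ?_
    obtain ⟨h, hh, hb⟩ := hF h' hh'
    have h1 : Continuous (toStep M h hh) :=
      continuous_iInf_dom (i := h) (continuous_iInf_dom (i := hh) continuous_induced_dom)
    exact hb.continuous_toLinearMap.comp h1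

lemma RoumieuS.exists_continuousLinearMap {M : ℕ → ℝ} {F : (ℝ → ℂ) → ℝ → ℂ}
    (hF : ∀ h : ℝ, 0 < h → ∃ h' : ℝ, 0 < h' ∧ StepBounded M F h h') :
    ∃ T : RoumieuS M →L[ℂ] RoumieuS M, ∀ φ : RoumieuS M, (T φ).1 = F φ.1 := by
  have hmem : ∀ φ ∈ roumieuSubmodule M, F φ ∈ roumieuSubmodule M := by
    rintro φ ⟨h, hh, hφ⟩
    obtain ⟨h', hh', hb⟩ := hF h hh
    exact ⟨h', hh', hb.mem φ hφ⟩
  let T : RoumieuS M →ₗ[ℂ] RoumieuS M :=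
    { toFun := fun φ => ⟨F φ.1, hmem φ.1 φ.2⟩
      map_add' := by
        rintro ⟨φ, h, hh, hφ⟩ ⟨ψ, k, hk, hψ⟩
        obtain ⟨h', hh', hb⟩ := hF (min h k) (lt_min hh hk)
        exact Subtype.ext (hb.map_add φ
          (mem_stepSubmodule_of_le (lt_min hh hk) (min_le_left _ _) hφ) ψ
          (mem_stepSubmodule_of_le (lt_min hh hk) (min_le_right _ _) hψ))
      map_smul' := by
        rintro c ⟨φ, h, hh, hφ⟩
        obtain ⟨h', hh', hb⟩ := hF h hh
        exact Subtype.ext (hb.map_smul c φ hφ) }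
  refine ⟨⟨T, ?_⟩, fun φ => rfl⟩
  -- For each admissible topology `t` on the target, its pullback along `T` is again admissible, so
  -- it is coarser than the inductive limit topology, the finest admissible one.
  refine continuous_sInf_rng.2 fun t ht => ?_
  rw [continuous_iff_le_induced]
  refine sInf_le ?_
  obtain ⟨h1, h2, h3, h4⟩ := ht
  let TR : RoumieuS M →ₗ[ℝ] RoumieuS M :=
    { toFun := T
      map_add' := T.map_add
      map_smul' := fun r φ => T.map_smul (r : ℂ) φ }
  refine ⟨topologicalAddGroup_induced T, continuousSMul_induced T, ?_, fun h hh => ?_⟩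
  · exact LocallyConvexSpace.induced TR
  · refine continuous_induced_rng.2 ?_
    obtain ⟨h', hh', hb⟩ := hF h hh
    exact (h4 h' hh').comp hb.continuous_toLinearMap

/-- `φ ↦ μ * φ` is a two-sided inverse of `P(i d/dt)` on functions for which the latter is
defined. -/
lemma exists_inverse_infiniteOrderOp {M L : ℕ → ℝ} (hM : IsWeightSequence M) {B : ℝ}
    (hB : ∀ q, |L q| ≤ B) :
    ∃ G : (ℝ → ℂ) → ℝ → ℂ,
      (∀ h : ℝ, 0 < h → ∀ φ ∈ stepSubmodule M h, G φ ∈ stepSubmodule M (h / 2)) ∧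
      ∀ h H C : ℝ, 0 < h → 1 ≤ H → 0 ≤ C →
        (∀ p α, ‖symbolCoeff M L p * Complex.I ^ p‖ * M (p + α) ≤
          C * (h / 2) ^ p * (H ^ α * M α)) →
        ∀ φ ∈ stepSubmodule M h,
          G (infiniteOrderOp (fun p => symbolCoeff M L p * Complex.I ^ p) φ) = φ ∧
          infiniteOrderOp (fun p => symbolCoeff M L p * Complex.I ^ p) (G φ) = φ := by
  obtain ⟨μ, hμ, ⟨a, ha, hexp⟩, hchar⟩ := exists_measure_charFun_mul_ultraSymbol hM hB
  refine ⟨measureConv μ, fun h hh φ hφ => measureConv_mem hM ha hexp hh hφ,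
    fun h H C hh hH hC hb φ hφ => ?_⟩
  have h1 := measureConv_infiniteOrderOp hM (symbolExpands hM hB) hchar hH hh hC hb hφ
  refine ⟨h1, ?_⟩
  -- With `φ` written as `μ * P φ` on the right only, the claim becomes the commutation `P (μ * φ) =
  -- μ * P φ`.
  rw [← h1]
  funext x
  conv_lhs => rw [h1]
  exact (hasSum_mul_iteratedDeriv_measureConv hM hH hh hC hb hφ x).tsum_eq

/-! ### The two cases of the theorem. -/

theorem lemma2 (M : ℕ → ℝ) (hM : IsWeightSequence M) :
    (∀ L : ℝ, 0 < L →
      SymbolExpands M (fun _ => L) ∧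
      ∃ T : BeurlingS M →L[ℂ] BeurlingS M,
        (∀ φ : BeurlingS M, IsUltraDeriv M (fun _ => L) φ (T φ)) ∧ Function.Bijective T) ∧
    (∀ L : ℕ → ℝ, Tendsto L atTop (𝓝 0) →
      SymbolExpands M L ∧
      ∃ T : RoumieuS M →L[ℂ] RoumieuS M,
        (∀ φ : RoumieuS M, IsUltraDeriv M L φ (T φ)) ∧ Function.Bijective T) := by
  obtain ⟨H, K, hH, hK, hc⟩ := exists_symbolCoeff_mul_le hM
  have hH0 : 0 < H := one_pos.trans_le hH
  refine ⟨fun L hL => ?_, fun L hL => ?_⟩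
  · have hLt : ∀ᶠ _q : ℕ in atTop, |L| * L⁻¹ ≤ 1 :=
      Eventually.of_forall fun _ => by rw [abs_of_pos hL, mul_inv_cancel₀ hL.ne']
    have hB : ∀ _q : ℕ, |L| ≤ |L| := fun _ => le_rfl
    -- For constant `L` the choice `t = 1 / L` makes the coefficient bounds available only for `h ≥
    -- K L`.
    have hcoeff := fun h (hh : K * L ≤ h) => hc (fun _ => L) L⁻¹ h (inv_pos.2 hL) hLt
      (by rwa [inv_mul_eq_div, le_div_iff₀ hL])
    refine ⟨symbolExpands hM hB, ?_⟩
    obtain ⟨G, hGmem, hG⟩ := exists_inverse_infiniteOrderOp hM hB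
    have hKL : 0 < K * L := mul_pos hK hL
    obtain ⟨C, hC, hb⟩ := hcoeff (K * L) le_rfl
    obtain ⟨T, hT⟩ := BeurlingS.exists_continuousLinearMap (M := M)
      (F := infiniteOrderOp fun p => symbolCoeff M (fun _ => L) p * Complex.I ^ p) fun h' hh' => by
        -- This source parameter meets the threshold `K L` and satisfies `h' ≤ h / H`.
        have hh : 0 < max (h' * H) (K * L) := lt_max_of_lt_right hKL
        obtain ⟨C, hC, hb⟩ := hcoeff (max (h' * H) (K * L)) (le_max_right _ _)
        exact ⟨_, hh, (stepBounded_infiniteOrderOp hM hH hh hC hb).mono_right hh'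
          ((le_div_iff₀ hH0).2 (le_max_left _ _))⟩
    refine ⟨T, fun φ t => ?_, Function.bijective_iff_has_inverse.2
      ⟨fun φ => ⟨G φ.1, mem_beurlingSubmodule_iff.2 fun h hh => ?_⟩, fun φ => Subtype.ext ?_,
        fun φ => Subtype.ext ?_⟩⟩
    · rw [hT]
      exact hasSum_infiniteOrderOp hM hH hKL hC hb (mem_step_of_beurling φ.2 hKL) t
    -- Starting from step `2 h` compensates for the halving under convolution.
    · have := hGmem (2 * h) (by positivity) φ.1 (mem_step_of_beurling φ.2 (by positivity))
      rwa [mul_div_cancel_left₀ _ two_ne_zero] at this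
    · simp only [hT]
      exact (hG _ H C hKL hH hC hb φ.1 (mem_step_of_beurling φ.2 hKL)).1
    · exact (hT _).trans (hG _ H C hKL hH hC hb φ.1 (mem_step_of_beurling φ.2 hKL)).2
  · have hLt : ∀ t : ℝ, 0 < t → ∀ᶠ q : ℕ in atTop, |L q| * t ≤ 1 := by
      intro t ht
      have h0 : Tendsto (fun q => |L q| * t) atTop (𝓝 0) := by
        simpa using hL.abs.mul_const t
      exact (h0.eventually (gt_mem_nhds one_pos)).mono fun _ h => h.le
    obtain ⟨B, hB⟩ := exists_abs_le_of_eventually one_pos (hLt 1 one_pos)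
    -- Because `L` tends to 0, `t` may be as large as `K / h`, so no lower bound on `h` remains.
    have hcoeff := fun h (hh : 0 < h) => hc L (K / h) h (div_pos hK hh) (hLt _ (div_pos hK hh))
      (div_mul_cancel₀ K hh.ne').ge
    refine ⟨symbolExpands hM hB, ?_⟩
    obtain ⟨G, hGmem, hG⟩ := exists_inverse_infiniteOrderOp hM hB
    obtain ⟨T, hT⟩ := RoumieuS.exists_continuousLinearMap (M := M)
      (F := infiniteOrderOp fun p => symbolCoeff M L p * Complex.I ^ p) fun h hh => by
        obtain ⟨C, hC, hb⟩ := hcoeff h hh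
        exact ⟨_, div_pos hh hH0, stepBounded_infiniteOrderOp hM hH hh hC hb⟩
    refine ⟨T, fun φ t => ?_, Function.bijective_iff_has_inverse.2
      ⟨fun φ => ⟨G φ.1, ?_⟩, fun φ => Subtype.ext ?_, fun φ => Subtype.ext ?_⟩⟩
    · obtain ⟨h, hh, hφ⟩ := φ.2
      obtain ⟨C, hC, hb⟩ := hcoeff h hh
      rw [hT]
      exact hasSum_infiniteOrderOp hM hH hh hC hb hφ t
    · obtain ⟨h, hh, hφ⟩ := φ.2
      exact ⟨h / 2, half_pos hh, hGmem h hh φ.1 hφ⟩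
    · obtain ⟨h, hh, hφ⟩ := φ.2
      obtain ⟨C, hC, hb⟩ := hcoeff h hh
      simp only [hT]
      exact (hG _ H C hh hH hC hb φ.1 hφ).1
    · obtain ⟨h, hh, hφ⟩ := φ.2
      obtain ⟨C, hC, hb⟩ := hcoeff h hh
      exact (hT _).trans (hG _ H C hh hH hC hb φ.1 hφ).2
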